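/- Let $\alpha\ge 2$, $\epsilon_F,\epsilon_B>0$ with $\frac1\alpha+2\epsilon_B+2\epsilon_F<1$. There are constants $a,C,\kappa,D>0$ and $\delta\in(0,1)$, depending only on $\alpha,\epsilon_F,\epsilon_B$, for which the following holds. **Setting.** Let $\phi:\mathbb R^n\to\mathbb R$ be convex and twice differentiable, with a minimal point $p^*$, normalized so that $\phi(p^*)=0$. Time $t\ge 0$ is continuous. Core $j$ ($1\le j\le n$) updates coordinate $p_j$ at an increasing sequence of times tending to infinity; consecutive updates of the same core are at most one time unit apart (all cores start at time $0$, which counts as the time of a zeroth update, without effect), and no two updates occur at the same time. Let $p^0$ be the initial point and let $p^t$ be the current point at time $t$, where an update made exactly at time $t$ is not yet included. For an update of $p_j$ at time $t$ let $\tau_j<t$ be the time of the previous update of $p_j$, put $\Delta t_j=t-\tau_j\le 1$, and for any coordinate $k$ let $\tau_k<t$ and $\sigma_k>t$ be the times of the last update of $p_k$ before $t$ and of the next one after $t$. Let $P_j^{[t_1,t_2]}(s)$ be the box of all $p$ with $p_j=s$ and, for $k\ne j$, with $p_k$ in the interval spanned by the values that the $k$-th coordinate takes during $[t_1,t_2]$.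 The update at time $t$ is $$p_j\leftarrow p_j-\frac{\nabla_j\phi(\tilde p)}{\gamma_j^t}\,\Delta t_j \qquad (1)$$ where $\gamma_j^t>0$ and $\tilde p$ is an arbitrary point of $P_j^{[\tau_j,t]}(p_j^t)$. Let $H_{kl}^{[t_1,t_2]}(s)=\sup\left\{\left|\frac{\partial^2\phi}{\partial p_k\partial p_l}(p')\right| : p'\in P_l^{[t_1,t_2]}(s)\right\}$. Assume that the $\gamma_j^t$ and the Hessian entries are *controlled*: there are positive numbers $\xi_k^t$ (for each update time $t$ of each $p_j$, and each $k\neq j$) such that, for every update, of $p_j$ at time $t$ say: * (A1) $\phi(p')-\phi(p^t)-\nabla_j\phi(p^t)(p'_j-p_j^t)\le\frac{\gamma_j^t}{\alpha}(p'_j-p_j^t)^2$ for every $p'$ that agrees with $p^t$ outside coordinate $j$ and whose $j$-th coordinate lies between the values of $p_j$ just before and just after the update; * (A2) $\gamma_j^t\le\overline\gamma_j$, where $\overline\gamma_j$ is finite and does not depend on $t$; put $\overline\gamma=\max_j\overline\gamma_j$; * (A3) $\sum_{k\ne j}\xi_k^t\,H_{jk}^{[t,\sigma_k]}(p_k^t)\le\epsilon_F\gamma_j^t$;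 * (A4) $\sum_{k\ne j}\left(\max_\beta\frac1{\xi_j^{\beta}}\right)H_{kj}^{[\tau_j,t]}(p_j^t)\le\epsilon_B\gamma_j^t$, where $\beta$ runs over the times of the updates of $p_k$ between $\tau_j$ and $t$ (the term is $0$ if there are none). **(a)** Suppose that $\{p' : \phi(p')\le 2\phi(p^0)\}$ is bounded, with diameter $B$, and let $M=a\,B^2\,\overline\gamma$. If $\phi(p^0)\le M$, then $\phi(p^t)\le C\,M/t$ for all $t>0$. If $\phi(p^0)>M$, then, with $t'=D\log\frac{\phi(p^0)}{M}$, we have $\phi(p^t)\le C\,2^{-\kappa t}\phi(p^0)$ for $0\le t\le t'$ and $\phi(p^t)\le C\,\frac{M}{t-t'}$ for $t>t'$. **(b)** Suppose that $\phi$ is strongly convex with parameter $c>0$, i.e. $\phi(p_2)\ge\phi(p_1)+\nabla\phi(p_1)\cdot(p_2-p_1)+\frac c2\|p_2-p_1\|^2$ for all $p_1,p_2$. Then $\phi(p^t)\le\left(1-\delta\frac{c}{\overline\gamma}\right)^t\phi(p^0)$ for all $t\ge 2$, and $\phi(p^t)\le 2\left(1-\delta\frac{c}{\overline\gamma}\right)^t\phi(p^0)$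 for all $t\ge 0$. -/

import Mathlib

open scoped ENNReal

/-- The partial derivative `∇_j φ`. -/
noncomputable def partialDeriv {n : ℕ} (j : Fin n) (φ : EuclideanSpace ℝ (Fin n) → ℝ)
    (x : EuclideanSpace ℝ (Fin n)) : ℝ :=
  fderiv ℝ φ x (EuclideanSpace.single j 1)

/-- `φ` is twice (Fréchet) differentiable everywhere. -/
def TwiceDifferentiable {n : ℕ} (φ : EuclideanSpace ℝ (Fin n) → ℝ) : Prop :=
  Differentiable ℝ φ ∧ Differentiable ℝ (fderiv ℝ φ)

/-- `H_{kl}(S)`, the supremum over `S` of `|∂²φ / ∂p_k ∂p_l|`, as an extended non-negative number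
(it is `∞` when the entry is unbounded on `S`). -/
noncomputable def hessianSup {n : ℕ} (φ : EuclideanSpace ℝ (Fin n) → ℝ) (k l : Fin n)
    (S : Set (EuclideanSpace ℝ (Fin n))) : ℝ≥0∞ :=
  ⨆ x ∈ S, ENNReal.ofReal |partialDeriv k (partialDeriv l φ) x|

/-- Strong convexity with parameter `c`, for a differentiable function. -/
def StronglyConvex {n : ℕ} (φ : EuclideanSpace ℝ (Fin n) → ℝ) (c : ℝ) : Prop :=
  ∀ x y : EuclideanSpace ℝ (Fin n),
    φ x + ∑ j, partialDeriv j φ x * (y j - x j) + c / 2 * ‖y - x‖ ^ 2 ≤ φ y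

/-- A schedule of coordinate updates in continuous time, with the values taken.
Core `j` makes its updates at the times `time j 1 < time j 2 < ⋯`, and `time j 0 = 0` is the common
starting time. The value of coordinate `j` is `val j 0` initially and `val j m` right after the
`m`-th update of core `j`. -/
structure Timeline (n : ℕ) where
  time : Fin n → ℕ → ℝ
  val : Fin n → ℕ → ℝ
  time_zero : ∀ j, time j 0 = 0
  time_strictMono : ∀ j, StrictMono (time j)
  /-- Only finitely many updates occur in a bounded period of time. -/
  time_tendsto : ∀ j, Filter.Tendsto (time j) Filter.atTop Filter.atTop
  /-- Consecutive updates to the same coordinate are at most one time unit apart. -/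
  gap_le_one : ∀ j m, time j (m + 1) - time j m ≤ 1
  /-- No two updates occur at the same time. -/
  time_ne : ∀ j k l m, j ≠ k → time j (l + 1) ≠ time k (m + 1)

namespace Timeline

variable {n : ℕ}

/-- The number of updates that core `k` has made strictly before time `t` (for `t > 0`); thus
`R.time k (R.idx k t)` is the time `τ_k` of the last update before `t`. -/
noncomputable def idx (R : Timeline n) (k : Fin n) (t : ℝ) : ℕ :=
  sSup {m : ℕ | R.time k m < t}

/-- The current point `p^t = p^{t-}`: an update made at time `t` is not yet taken into account. -/
noncomputable def pos (R : Timeline n) (t : ℝ) : EuclideanSpace ℝ (Fin n) :=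
  WithLp.toLp 2 fun k => R.val k (R.idx k t)

/-- The time `σ_k` of the next update to coordinate `k`, for a time `t` at which another coordinate
is updated. -/
noncomputable def nextTime (R : Timeline n) (k : Fin n) (t : ℝ) : ℝ :=
  R.time k (R.idx k t + 1)

/-- The rectangular box with `j`-th coordinate `s` and whose other coordinates span the ranges of
values of `p_k` that occur during `[t₁, t₂]`. -/
def box (R : Timeline n) (j : Fin n) (t₁ t₂ s : ℝ) : Set (EuclideanSpace ℝ (Fin n)) :=
  {x | x j = s ∧ ∀ k, k ≠ j → x k ∈ convexHull ℝ ((fun t => R.pos t k) '' Set.Icc t₁ t₂)}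

end Timeline

/-- A run of asynchronous gradient descent on `φ`. The `(m + 1)`-th update of core `j`, made at time
`t = time j (m + 1)` and following its update at time `τ_j = time j m`, uses a gradient computed at
the point `dated j m` and the step size `1 / γ j m`. -/
structure AGDRun {n : ℕ} (φ : EuclideanSpace ℝ (Fin n) → ℝ) extends Timeline n where
  dated : Fin n → ℕ → EuclideanSpace ℝ (Fin n)
  γ : Fin n → ℕ → ℝ
  γ_pos : ∀ j m, 0 < γ j m
  dated_mem : ∀ j m, dated j m ∈ toTimeline.box j (time j m) (time j (m + 1)) (val j m)
  update : ∀ j m, val j (m + 1) =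
    val j m - partialDeriv j φ (dated j m) / γ j m * (time j (m + 1) - time j m)

/-- The step sizes and the Hessian entries are controlled, with constants `α`, `εF`, `εB` and upper
bounds `γbar j` on the step-size parameters of core `j`. The number `ξ j m k` is attached to the
`(m + 1)`-th update of core `j` and to the coordinate `k ≠ j`. -/
def AGDRun.Controlled {n : ℕ} {φ : EuclideanSpace ℝ (Fin n) → ℝ} (R : AGDRun φ)
    (α εF εB : ℝ) (γbar : Fin n → ℝ) : Prop :=
  -- upper bound on the step-size parameters
  (∀ j m, R.γ j m ≤ γbar j) ∧
  -- local Lipschitz bound, between the points before and after the update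
  (∀ j m, ∀ x : EuclideanSpace ℝ (Fin n),
    (∀ k, k ≠ j → x k = R.pos (R.time j (m + 1)) k) →
    x j ∈ Set.uIcc (R.val j m) (R.val j (m + 1)) →
    φ x - φ (R.pos (R.time j (m + 1)))
        - partialDeriv j φ (R.pos (R.time j (m + 1))) * (x j - R.val j m)
      ≤ R.γ j m / α * (x j - R.val j m) ^ 2) ∧
  ∃ ξ : Fin n → ℕ → Fin n → ℝ,
    (∀ j m k, k ≠ j → 0 < ξ j m k) ∧
    -- bound on nearby future Hessian entries
    (∀ j m, ∑ k ∈ Finset.univ.erase j, ENNReal.ofReal (ξ j m k) *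
        hessianSup φ j k (R.box k (R.time j (m + 1)) (R.nextTime k (R.time j (m + 1)))
          (R.pos (R.time j (m + 1)) k))
      ≤ ENNReal.ofReal (εF * R.γ j m)) ∧
    -- bound on recent past Hessian entries; the inner supremum runs over the updates of core
    -- `k` between the two updates of core `j` (there is no contribution if there are none)
    (∀ j m, ∑ k ∈ Finset.univ.erase j,
        (⨆ l : ℕ, ⨆ _ : R.time k (l + 1) ∈ Set.Ioo (R.time j m) (R.time j (m + 1)),
          ENNReal.ofReal (1 / ξ k l j)) *
        hessianSup φ k j (R.box j (R.time j m) (R.time j (m + 1)) (R.val j m))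
      ≤ ENNReal.ofReal (εB * R.γ j m))

/-! ### Update schedules: indices, windows and boxes. -/

namespace Timeline

variable {n : ℕ} (R : Timeline n)

/-! Give an update that moves a coordinate by `s` after a cycle of length `Δ ≤ 1` the energy `E = γ
s² / Δ`. The gradient `g'` that was used satisfies `g' s = -E`, so with an exact gradient (A1) would
lower `φ` by at least `(1 - 1/α) E`. The gradient is stale, however, and the error is charged to the
updates that caused it: each update of `p_k` issues to the next update of every other core `j` the
charge `ξ H_{kj} s² / Δ`. By (A3) an update issues at most `εF E` in total; by Cauchy–Schwarz and
(A4), an update that receives charges `V` has squared gradient error at most `2 εB γ V`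
(`Controlled.exists_isCharge`).

Hence the potential, `φ` plus half of the charges issued but not yet received, drops at each update
by at least `(1 - 1/α - εB - εF/2) E` (`Controlled.potentialStep_le`). It dominates `φ`, and exceeds
it by at most `εF/2` times the energy of the last time unit.

Conversely, little energy forces a small gradient: averaging over a unit of time yields a moment `s`
at which `‖∇φ‖²` is at most three times `sup γbar` times the energy `S` of the surrounding three
time units (`Controlled.exists_sum_sq_partialDeriv_le`). Convexity turns this into a bound on `φ` at
`s`, hence on the potential `P` afterwards, while `P` has lost a fixed fraction of `S`. The outcome
is a recursive inequality between `P T` and `P (T + 3)`. In case (a) its decrement is proportional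
to `P` while `P ≥ M` and to `P² / M` below `M`, which gives a geometric and then a harmonic phase;
in case (b) it is a contraction. -/

theorem time_nonneg (k : Fin n) (l : ℕ) : 0 ≤ R.time k l := by
  rw [← R.time_zero k]; exact (R.time_strictMono k).monotone (Nat.zero_le l)

theorem time_succ_pos (k : Fin n) (l : ℕ) : 0 < R.time k (l + 1) := by
  rw [← R.time_zero k]; exact R.time_strictMono k (Nat.succ_pos l)

/-- Valid for every real `t`: if `t ≤ 0` the defining set is empty and `sSup ∅ = 0`. Time intervals
that reach back before the start therefore need no separate treatment. -/
theorem lt_idx_iff {k : Fin n} {l : ℕ} {t : ℝ} : l < R.idx k t ↔ R.time k (l + 1) < t := by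
  have hbdd : BddAbove {m : ℕ | R.time k m < t} := by
    obtain ⟨N, hN⟩ := (R.time_tendsto k).eventually_ge_atTop t |>.exists
    refine ⟨N, fun m hm => ?_⟩
    by_contra h
    have := R.time_strictMono k (not_le.1 h)
    simp only [Set.mem_ofPred_eq] at hm
    linarith
  constructor
  · intro h
    have hne : {m : ℕ | R.time k m < t}.Nonempty := by
      rw [Set.nonempty_iff_ne_empty]
      intro h0
      simp [idx, h0] at h
    have hmem : R.time k (R.idx k t) < t := Nat.sSup_mem hne hbdd
    exact ((R.time_strictMono k).monotone (Nat.succ_le_of_lt h)).trans_lt hmem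
  · intro h
    exact Nat.lt_of_succ_le (le_csSup hbdd h)

theorem idx_mono (k : Fin n) : Monotone (R.idx k) := by
  intro s t hst
  refine le_of_forall_lt fun l hl => ?_
  rw [lt_idx_iff] at hl ⊢
  exact hl.trans_le hst

theorem idx_of_nonpos (k : Fin n) {t : ℝ} (ht : t ≤ 0) : R.idx k t = 0 := by
  by_contra h
  have := (R.lt_idx_iff (k := k) (l := 0)).1 (Nat.pos_of_ne_zero h)
  linarith [R.time_succ_pos k 0]

theorem idx_time_succ (k : Fin n) (m : ℕ) : R.idx k (R.time k (m + 1)) = m := by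
  refine eq_of_forall_lt_iff fun l => ?_
  rw [lt_idx_iff, (R.time_strictMono k).lt_iff_lt]
  omega

theorem time_idx_lt (k : Fin n) {t : ℝ} (ht : 0 < t) : R.time k (R.idx k t) < t := by
  rcases h : R.idx k t with _ | l
  · rwa [R.time_zero]
  · exact R.lt_idx_iff.1 (by omega)

theorem time_idx_le (k : Fin n) {t : ℝ} (ht : 0 ≤ t) : R.time k (R.idx k t) ≤ t := by
  rcases ht.eq_or_lt with rfl | ht
  · rw [R.idx_of_nonpos k le_rfl, R.time_zero]
  · exact (R.time_idx_lt k ht).le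

theorem le_time_idx_succ (k : Fin n) (t : ℝ) : t ≤ R.time k (R.idx k t + 1) := by
  by_contra h
  exact lt_irrefl _ (R.lt_idx_iff.2 (not_le.1 h))

theorem sub_one_le_time_idx (k : Fin n) (t : ℝ) : t - 1 ≤ R.time k (R.idx k t) := by
  linarith [R.le_time_idx_succ k t, R.gap_le_one k (R.idx k t)]

theorem idx_time_of_mem {j k : Fin n} (hjk : j ≠ k) {m l : ℕ}
    (h₁ : R.time j m ≤ R.time k (l + 1)) (h₂ : R.time k (l + 1) < R.time j (m + 1)) :
    R.idx j (R.time k (l + 1)) = m := by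
  refine eq_of_forall_lt_iff fun i => ?_
  rw [lt_idx_iff]
  constructor
  · intro h
    have := (R.time_strictMono j).lt_iff_lt.1 (h.trans h₂)
    omega
  · intro h
    refine lt_of_le_of_ne (((R.time_strictMono j).monotone h).trans h₁) (R.time_ne j k i l hjk)

@[simp]
theorem pos_apply (t : ℝ) (k : Fin n) : R.pos t k = R.val k (R.idx k t) := rfl

/-- The duration of the `m`-th cycle of core `j`. -/
def dur (j : Fin n) (m : ℕ) : ℝ := R.time j (m + 1) - R.time j m

theorem dur_pos (j : Fin n) (m : ℕ) : 0 < R.dur j m :=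
  sub_pos.2 (R.time_strictMono j (Nat.lt_succ_self m))

theorem dur_le_one (j : Fin n) (m : ℕ) : R.dur j m ≤ 1 := R.gap_le_one j m

/-- The updates of core `k` during the `m`-th cycle of core `j`. -/
noncomputable def window (k j : Fin n) (m : ℕ) : Finset ℕ :=
  Finset.Ico (R.idx k (R.time j m)) (R.idx k (R.time j (m + 1)))

theorem mem_window {k j : Fin n} {m l : ℕ} :
    l ∈ R.window k j m ↔ R.time j m ≤ R.time k (l + 1) ∧ R.time k (l + 1) < R.time j (m + 1) := by
  rw [window, Finset.mem_Ico, R.lt_idx_iff, ← not_lt, R.lt_idx_iff, not_lt]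

theorem time_lt_of_mem_window {k j : Fin n} (hkj : k ≠ j) {m l : ℕ} (hl : l ∈ R.window k j m) :
    R.time j m < R.time k (l + 1) := by
  refine lt_of_le_of_ne (R.mem_window.1 hl).1 ?_
  cases m with
  | zero => rw [R.time_zero]; exact (R.time_succ_pos k l).ne
  | succ m => exact R.time_ne j k m l hkj.symm

/-- The durations telescope. The window has length at most one, and the cycle of core `k` in
progress when it opens began at most one unit earlier. -/
theorem sum_dur_window_le (k j : Fin n) (m : ℕ) : ∑ l ∈ R.window k j m, R.dur k l ≤ 2 := by
  have hmono : R.idx k (R.time j m) ≤ R.idx k (R.time j (m + 1)) :=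
    R.idx_mono k ((R.time_strictMono j).monotone (Nat.le_succ m))
  have : ∑ l ∈ R.window k j m, R.dur k l =
      R.time k (R.idx k (R.time j (m + 1))) - R.time k (R.idx k (R.time j m)) :=
    Finset.sum_Ico_sub (R.time k) hmono
  rw [this]
  linarith [R.time_idx_le k (R.time_nonneg j (m + 1)), R.sub_one_le_time_idx k (R.time j m),
    R.gap_le_one j m]

theorem sum_Ico_sum_window (k j : Fin n) (f : ℕ → ℝ) {a b : ℕ} (hab : a ≤ b) :
    ∑ m ∈ Finset.Ico a b, ∑ l ∈ R.window k j m, f l =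
      ∑ l ∈ Finset.Ico (R.idx k (R.time j a)) (R.idx k (R.time j b)), f l := by
  have hmono : Monotone fun m => R.idx k (R.time j m) :=
    (R.idx_mono k).comp (R.time_strictMono j).monotone
  induction b, hab using Nat.le_induction with
  | base => simp
  | succ b hab ih =>
    rw [Finset.sum_Ico_succ_top hab, ih, window,
      Finset.sum_Ico_consecutive _ (hmono hab) (hmono b.le_succ)]

/-- The point right after the `(m + 1)`-th update of core `j`. -/
noncomputable def posAfter (j : Fin n) (m : ℕ) : EuclideanSpace ℝ (Fin n) :=
  WithLp.toLp 2 (Function.update (R.pos (R.time j (m + 1))).ofLp j (R.val j (m + 1)))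

theorem posAfter_self (j : Fin n) (m : ℕ) : R.posAfter j m j = R.val j (m + 1) := by
  simp [posAfter]

theorem posAfter_of_ne {j k : Fin n} (h : k ≠ j) (m : ℕ) :
    R.posAfter j m k = R.pos (R.time j (m + 1)) k := by
  simp [posAfter, h]

/-- Telescoping over all updates in chronological order, organized as an induction on their number
that peels off the latest one. -/
theorem apply_pos_eq_add_sum (f : EuclideanSpace ℝ (Fin n) → ℝ) (T : ℝ) :
    f (R.pos T) = f (R.pos 0) + ∑ j, ∑ m ∈ Finset.range (R.idx j T),
      (f (R.posAfter j m) - f (R.pos (R.time j (m + 1)))) := by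
  induction hN : ∑ j, R.idx j T using Nat.strong_induction_on generalizing T with
  | _ N ih =>
  by_cases h0 : ∀ j, R.idx j T = 0
  · have : R.pos T = R.pos 0 := by
      ext k
      rw [pos_apply, pos_apply, h0, R.idx_of_nonpos k le_rfl]
    simp [this, h0]
  · push Not at h0
    obtain ⟨j, hj, hmax⟩ := Finset.exists_max_image (Finset.univ.filter fun j => R.idx j T ≠ 0)
      (fun j => R.time j (R.idx j T)) (by simpa [Finset.filter_nonempty_iff] using h0)
    simp only [Finset.mem_filter, Finset.mem_univ, true_and] at hj hmax
    obtain ⟨m, hm⟩ := Nat.exists_eq_succ_of_ne_zero hj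
    rw [Nat.succ_eq_add_one] at hm
    have htT : R.time j (m + 1) < T := R.lt_idx_iff.1 (by omega)
    have hidx : ∀ k, k ≠ j → R.idx k (R.time j (m + 1)) = R.idx k T := by
      intro k hk
      refine le_antisymm (R.idx_mono k htT.le) (le_of_forall_lt fun i hi => ?_)
      rw [R.lt_idx_iff]
      refine lt_of_le_of_ne ?_ (R.time_ne k j i m hk)
      have := hmax k (by omega)
      rw [hm] at this
      exact ((R.time_strictMono k).monotone hi).trans this
    have hpos : R.pos T = R.posAfter j m := by
      ext k
      by_cases hk : k = j
      · subst hk; rw [pos_apply, posAfter_self, hm]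
      · rw [posAfter_of_ne _ hk, pos_apply, pos_apply, hidx k hk]
    have hsum : ∀ (g : Fin n → ℕ → ℝ), ∑ k, ∑ i ∈ Finset.range (R.idx k T), g k i =
        ∑ k, ∑ i ∈ Finset.range (R.idx k (R.time j (m + 1))), g k i + g j m := by
      intro g
      have hrest : ∑ k ∈ Finset.univ.erase j, ∑ i ∈ Finset.range (R.idx k T), g k i =
          ∑ k ∈ Finset.univ.erase j, ∑ i ∈ Finset.range (R.idx k (R.time j (m + 1))), g k i :=
        Finset.sum_congr rfl fun k hk => by rw [hidx k (Finset.ne_of_mem_erase hk)]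
      rw [← Finset.add_sum_erase _ _ (Finset.mem_univ j), hrest,
        ← Finset.add_sum_erase (a := j) Finset.univ
          (fun k => ∑ i ∈ Finset.range (R.idx k (R.time j (m + 1))), g k i) (Finset.mem_univ j), hm,
        R.idx_time_succ, Finset.sum_range_succ]
      ring
    have hlt : ∑ k, R.idx k (R.time j (m + 1)) < N := by
      rw [← hN]
      refine Finset.sum_lt_sum (fun k _ => R.idx_mono k htT.le) ⟨j, Finset.mem_univ j, ?_⟩
      rw [R.idx_time_succ]; omega
    rw [hsum, ← add_assoc, ← ih _ hlt _ rfl, hpos]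
    ring

/-- The values of the coordinates with indices in `[a k, b k]`, apart from a fixed coordinate. -/
def indexBox (j : Fin n) (s : ℝ) (a b : Fin n → ℕ) : Set (EuclideanSpace ℝ (Fin n)) :=
  {x | x j = s ∧ ∀ k, k ≠ j → x k ∈ convexHull ℝ (R.val k '' Set.Icc (a k) (b k))}

theorem box_subset_indexBox (j : Fin n) (t₁ t₂ s : ℝ) :
    R.box j t₁ t₂ s ⊆ R.indexBox j s (fun k => R.idx k t₁) (fun k => R.idx k t₂) := by
  rintro x ⟨hj, hx⟩
  refine ⟨hj, fun k hk => convexHull_mono ?_ (hx k hk)⟩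
  rintro _ ⟨t, ht, rfl⟩
  exact ⟨R.idx k t, ⟨R.idx_mono k ht.1, R.idx_mono k ht.2⟩, rfl⟩

/-- The value with index `i` is still current at the time of update `i + 1`, because `pos` does not
yet include an update made at that very moment. -/
theorem indexBox_subset_box (j : Fin n) {t₁ t₂ s : ℝ} (h : t₁ ≤ t₂) {a : Fin n → ℕ}
    (ha : ∀ k, k ≠ j → a k < R.idx k t₂ → t₁ ≤ R.time k (a k + 1)) :
    R.indexBox j s a (fun k => R.idx k t₂) ⊆ R.box j t₁ t₂ s := by
  rintro x ⟨hj, hx⟩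
  refine ⟨hj, fun k hk => convexHull_mono ?_ (hx k hk)⟩
  rintro _ ⟨i, ⟨hi₁, hi₂⟩, rfl⟩
  rcases hi₂.eq_or_lt with hi | hi
  · exact ⟨t₂, ⟨h, le_rfl⟩, by simp [hi]⟩
  · refine ⟨R.time k (i + 1), ⟨?_, (R.lt_idx_iff.1 hi).le⟩, by simp [R.idx_time_succ]⟩
    exact (ha k hk (hi₁.trans_lt hi)).trans ((R.time_strictMono k).monotone (by omega))

theorem box_mono_left (j : Fin n) {t₁ t₁' t₂ s : ℝ} (h : t₁ ≤ t₁') :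
    R.box j t₁' t₂ s ⊆ R.box j t₁ t₂ s := fun _ hx =>
  ⟨hx.1, fun k hk => convexHull_mono (Set.image_mono (Set.Icc_subset_Icc_left h)) (hx.2 k hk)⟩

theorem pos_mem_box (j : Fin n) {t t₁ t₂ : ℝ} (ht : t ∈ Set.Icc t₁ t₂) :
    R.pos t ∈ R.box j t₁ t₂ (R.pos t j) :=
  ⟨rfl, fun _ _ => subset_convexHull ℝ _ ⟨t, ht, rfl⟩⟩

end Timeline

/-- Removing the first of a sequence of points shrinks the hull by at most the first step. -/
theorem exists_mem_convexHull_image_Icc_succ {v : ℕ → ℝ} {a b : ℕ} (hab : a < b) {x : ℝ}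
    (hx : x ∈ convexHull ℝ (v '' Set.Icc a b)) :
    ∃ y ∈ convexHull ℝ (v '' Set.Icc (a + 1) b), |x - y| ≤ |v (a + 1) - v a| := by
  have hne : (v '' Set.Icc (a + 1) b).Nonempty := (Set.nonempty_Icc.2 hab).image v
  have hins : v '' Set.Icc a b = insert (v a) (v '' Set.Icc (a + 1) b) := by
    rw [← Set.image_insert_eq]
    congr 1
    ext i
    simp only [Set.mem_Icc, Set.mem_insert_iff]
    omega
  rw [hins, convexHull_insert hne, mem_convexJoin] at hx
  obtain ⟨_, rfl, y, hy, p, q, hp, hq, hpq, rfl⟩ := hx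
  have hmem : v (a + 1) ∈ convexHull ℝ (v '' Set.Icc (a + 1) b) :=
    subset_convexHull ℝ _ ⟨a + 1, ⟨le_rfl, hab⟩, rfl⟩
  -- Keep the weights and replace the lost vertex `v a` by `v (a + 1)`.
  refine ⟨p • v (a + 1) + q • y, convex_convexHull ℝ _ hmem hy hp hq hpq, ?_⟩
  have : p • v a + q • y - (p • v (a + 1) + q • y) = -(p * (v (a + 1) - v a)) := by
    simp only [smul_eq_mul]; ring
  rw [this, abs_neg, abs_mul, abs_of_nonneg hp]
  exact mul_le_of_le_one_left (abs_nonneg _) (by linarith)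

/-! ### Partial derivatives and Hessian bounds. -/

variable {n : ℕ} {φ : EuclideanSpace ℝ (Fin n) → ℝ}

theorem abs_partialDeriv_le_toReal_hessianSup {k j : Fin n} {S : Set (EuclideanSpace ℝ (Fin n))}
    (hS : hessianSup φ k j S ≠ ∞) {x : EuclideanSpace ℝ (Fin n)} (hx : x ∈ S) :
    |partialDeriv k (partialDeriv j φ) x| ≤ (hessianSup φ k j S).toReal := by
  rw [← ENNReal.ofReal_le_iff_le_toReal hS]
  exact le_iSup₂_of_le x hx le_rfl

theorem hessianSup_mono (k j : Fin n) {S T : Set (EuclideanSpace ℝ (Fin n))} (h : S ⊆ T) :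
    hessianSup φ k j S ≤ hessianSup φ k j T :=
  biSup_mono fun _ hx => h hx

theorem TwiceDifferentiable.differentiable_partialDeriv (hφ : TwiceDifferentiable φ) (j : Fin n) :
    Differentiable ℝ (partialDeriv j φ) :=
  hφ.2.clm_apply (differentiable_const _)

theorem fderiv_apply_eq_sum (f : EuclideanSpace ℝ (Fin n) → ℝ) (x v : EuclideanSpace ℝ (Fin n)) :
    fderiv ℝ f x v = ∑ j, partialDeriv j f x * v j := by
  have hv : v = ∑ j, v j • EuclideanSpace.single j (1 : ℝ) := by
    ext i
    simp [Finset.sum_apply, Pi.single_apply]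
  conv_lhs => rw [hv, map_sum]
  refine Finset.sum_congr rfl fun j _ => ?_
  rw [map_smul, smul_eq_mul, mul_comm, partialDeriv]

/-- The mean value inequality along a coordinate direction. -/
theorem abs_sub_le_of_partialDeriv_bound {f : EuclideanSpace ℝ (Fin n) → ℝ}
    (hf : Differentiable ℝ f) {k : Fin n} {x y : EuclideanSpace ℝ (Fin n)}
    (hxy : ∀ i, i ≠ k → x i = y i) {C : ℝ}
    (hC : ∀ z ∈ segment ℝ x y, |partialDeriv k f z| ≤ C) :
    |f x - f y| ≤ C * |x k - y k| := by
  have hderiv : ∀ s ∈ Set.Icc (0 : ℝ) 1,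
      HasDerivWithinAt (fun s : ℝ => f (x + s • (y - x)))
        (fderiv ℝ f (x + s • (y - x)) (y - x)) (Set.Icc 0 1) s := by
    intro s _
    have h1 : HasDerivAt (fun s : ℝ => x + s • (y - x)) (y - x) s := by
      simpa using ((hasDerivAt_id s).smul_const (y - x)).const_add x
    exact ((hf _).hasFDerivAt.comp_hasDerivAt s h1).hasDerivWithinAt
  have hbound : ∀ s ∈ Set.Ico (0 : ℝ) 1,
      ‖fderiv ℝ f (x + s • (y - x)) (y - x)‖ ≤ C * |x k - y k| := by
    intro s hs
    rw [fderiv_apply_eq_sum, Finset.sum_eq_single k, Real.norm_eq_abs, abs_mul, abs_sub_comm (x k)]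
    · refine mul_le_mul_of_nonneg_right (hC _ ?_) (abs_nonneg _)
      rw [segment_eq_image']
      exact ⟨s, ⟨hs.1, hs.2.le⟩, rfl⟩
    · intro i _ hi
      simp [hxy i hi]
    · simp
  have := norm_image_sub_le_of_norm_deriv_le_segment_01' hderiv hbound
  simpa [abs_sub_comm] using this

theorem Timeline.segment_subset_indexBox (R : Timeline n) {j : Fin n} {s : ℝ} {a b : Fin n → ℕ}
    {x y : EuclideanSpace ℝ (Fin n)} (hx : x ∈ R.indexBox j s a b) (hy : y ∈ R.indexBox j s a b) :
    segment ℝ x y ⊆ R.indexBox j s a b := by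
  rintro _ ⟨p, q, hp, hq, hpq, rfl⟩
  refine ⟨?_, fun k hk => ?_⟩
  · simp [hx.1, hy.1, ← add_mul, hpq]
  · exact convex_convexHull ℝ _ (hx.2 k hk) (hy.2 k hk) hp hq hpq

/-! ### Gradient errors and the charges that pay for them. -/

namespace AGDRun

variable (R : AGDRun φ)

/-- The change made by the `(m + 1)`-th update of core `j`. -/
def step (j : Fin n) (m : ℕ) : ℝ := R.val j (m + 1) - R.val j m

/-- The progress that the `(m + 1)`-th update of core `j` would make on dated information. -/
noncomputable def energy (j : Fin n) (m : ℕ) : ℝ := R.γ j m * R.step j m ^ 2 / R.dur j m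

theorem energy_nonneg (j : Fin n) (m : ℕ) : 0 ≤ R.energy j m :=
  div_nonneg (mul_nonneg (R.γ_pos j m).le (sq_nonneg _)) (R.dur_pos j m).le

/-- The bound on the mixed second derivative `∂_k ∂_j φ` between the `(l + 1)`-th update of
core `k` and the next update of core `j`. -/
noncomputable def coupling (k : Fin n) (l : ℕ) (j : Fin n) : ℝ :=
  (hessianSup φ k j (R.box j (R.time k (l + 1)) (R.nextTime j (R.time k (l + 1)))
    (R.pos (R.time k (l + 1)) j))).toReal

theorem coupling_nonneg (k : Fin n) (l : ℕ) (j : Fin n) : 0 ≤ R.coupling k l j :=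
  ENNReal.toReal_nonneg

theorem coupling_eq {k j : Fin n} (hkj : k ≠ j) {m l : ℕ} (hl : l ∈ R.window k j m) :
    R.coupling k l j = (hessianSup φ k j
      (R.box j (R.time k (l + 1)) (R.time j (m + 1)) (R.val j m))).toReal := by
  have hl' := R.mem_window.1 hl
  have := R.idx_time_of_mem hkj.symm hl'.1 hl'.2
  rw [coupling, Timeline.nextTime, Timeline.pos_apply, this]

/-- Walk from `x` to the current point by discarding outdated coordinate values one update at a
time, in chronological order. Discarding the value replaced by update `l` of core `k` moves `x k` by
at most `|step k l|`, inside a box that involves only values current from that update on. So the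
future Hessian bound of (A3) applies. Finiteness is needed because `toReal ∞ = 0`. -/
theorem abs_partialDeriv_sub_le (hφ : TwiceDifferentiable φ) {j : Fin n} {m : ℕ}
    (hfin : ∀ k, k ≠ j → (R.window k j m).Nonempty →
      hessianSup φ k j (R.box j (R.time j m) (R.time j (m + 1)) (R.val j m)) ≠ ∞)
    {x : EuclideanSpace ℝ (Fin n)}
    (hx : x ∈ R.box j (R.time j m) (R.time j (m + 1)) (R.val j m)) :
    |partialDeriv j φ x - partialDeriv j φ (R.pos (R.time j (m + 1)))| ≤
      ∑ k ∈ Finset.univ.erase j, ∑ l ∈ R.window k j m, R.coupling k l j * |R.step k l| := by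
  set t := R.time j (m + 1) with ht
  set b : Fin n → ℕ := fun k => R.idx k t with hb
  have main : ∀ N : ℕ, ∀ a : Fin n → ℕ, ∑ k ∈ Finset.univ.erase j, (b k - a k) = N →
      (∀ k, k ≠ j → R.idx k (R.time j m) ≤ a k) → (∀ k, k ≠ j → a k ≤ b k) →
      ∀ x ∈ R.indexBox j (R.val j m) a b,
      |partialDeriv j φ x - partialDeriv j φ (R.pos t)| ≤
        ∑ k ∈ Finset.univ.erase j, ∑ l ∈ Finset.Ico (a k) (b k),
          R.coupling k l j * |R.step k l| := by
    intro N
    induction N with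
    | zero =>
      intro a hN _ hab x hx
      have hxt : x = R.pos t := by
        ext k
        by_cases hk : k = j
        · subst hk
          rw [hx.1, Timeline.pos_apply, ht, R.idx_time_succ]
        · have hx2 := hx.2 k hk
          have h0 : b k - a k = 0 :=
            (Finset.sum_eq_zero_iff.1 hN) k (Finset.mem_erase.2 ⟨hk, Finset.mem_univ k⟩)
          have : a k = b k := le_antisymm (hab k hk) (by omega)
          rw [this, Set.Icc_self, Set.image_singleton, convexHull_singleton,
            Set.mem_singleton_iff] at hx2
          exact hx2
      rw [hxt, sub_self, abs_zero]
      exact Finset.sum_nonneg fun k _ => Finset.sum_nonneg fun l _ =>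
        mul_nonneg (R.coupling_nonneg k l j) (abs_nonneg _)
    | succ N ih =>
      intro a hN hlow hab x hx
      have hex : ((Finset.univ.erase j).filter fun k => a k < b k).Nonempty := by
        by_contra h
        rw [Finset.not_nonempty_iff_eq_empty, Finset.filter_eq_empty_iff] at h
        have : ∑ k ∈ Finset.univ.erase j, (b k - a k) = 0 :=
          Finset.sum_eq_zero fun k hk => by have := h hk; omega
        omega
      -- The earliest remaining update: all values still in play then occur from its time on.
      obtain ⟨k, hk, hmin⟩ := Finset.exists_min_image _ (fun k => R.time k (a k + 1)) hex
      simp only [Finset.mem_filter, Finset.mem_erase, Finset.mem_univ, and_true] at hk hmin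
      obtain ⟨hkj, hkab⟩ := hk
      have hwin : a k ∈ R.window k j m := Finset.mem_Ico.2 ⟨hlow k hkj, hkab⟩
      set a' := Function.update a k (a k + 1) with ha'
      obtain ⟨y, hy, hxy⟩ := exists_mem_convexHull_image_Icc_succ hkab (hx.2 k hkj)
      set x' : EuclideanSpace ℝ (Fin n) := WithLp.toLp 2 (Function.update x.ofLp k y) with hx'
      have hx'k : x' k = y := by simp [hx']
      have hx'i : ∀ i, i ≠ k → x' i = x i := fun i hi => by simp [hx', hi]
      have hx'mem : x' ∈ R.indexBox j (R.val j m) a' b := by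
        refine ⟨by rw [hx'i j hkj.symm, hx.1], fun i hi => ?_⟩
        by_cases hik : i = k
        · subst hik
          rw [hx'k, ha', Function.update_self]
          exact hy
        · rw [hx'i i hik, ha', Function.update_of_ne hik]
          exact hx.2 i hi
      have hx'mem2 : x' ∈ R.indexBox j (R.val j m) a b := by
        refine ⟨hx'mem.1, fun i hi => convexHull_mono (Set.image_mono
          (Set.Icc_subset_Icc_left ?_)) (hx'mem.2 i hi)⟩
        by_cases hik : i = k
        · subst hik; simp [ha']
        · simp [ha', hik]
      have hsub : R.indexBox j (R.val j m) a b ⊆ R.box j (R.time k (a k + 1)) t (R.val j m) :=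
        R.indexBox_subset_box j (R.mem_window.1 hwin).2.le fun i hi hilt => hmin i ⟨hi, hilt⟩
      have hfin' : hessianSup φ k j (R.box j (R.time k (a k + 1)) t (R.val j m)) ≠ ∞ :=
        ne_top_of_le_ne_top (hfin k hkj ⟨_, hwin⟩)
          (hessianSup_mono k j (R.box_mono_left j (R.mem_window.1 hwin).1))
      have hstep : |partialDeriv j φ x - partialDeriv j φ x'| ≤
          R.coupling k (a k) j * |R.step k (a k)| := by
        have h1 := abs_sub_le_of_partialDeriv_bound (hφ.differentiable_partialDeriv j) (k := k)
          (x := x) (y := x') (fun i hi => (hx'i i hi).symm)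
          (C := R.coupling k (a k) j) (fun z hz => by
            rw [R.coupling_eq hkj hwin]
            exact abs_partialDeriv_le_toReal_hessianSup hfin'
              (hsub (R.segment_subset_indexBox hx hx'mem2 hz)))
        rw [hx'k] at h1
        exact h1.trans (mul_le_mul_of_nonneg_left hxy (R.coupling_nonneg _ _ _))
      have hkmem : k ∈ Finset.univ.erase j := Finset.mem_erase.2 ⟨hkj, Finset.mem_univ k⟩
      have hother : ∀ i ∈ (Finset.univ.erase j).erase k, a' i = a i := fun i hi => by
        rw [ha', Function.update_of_ne (Finset.ne_of_mem_erase hi)]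
      have hIH := ih a' (by
          rw [← Finset.add_sum_erase _ _ hkmem] at hN ⊢
          rw [Finset.sum_congr rfl fun i hi => by rw [hother i hi], ha', Function.update_self]
          omega)
        (fun i hi => (hlow i hi).trans (by
          by_cases hik : i = k
          · subst hik; simp [ha']
          · simp [ha', hik]))
        (fun i hi => by
          by_cases hik : i = k
          · subst hik; simpa [ha'] using hkab
          · simpa [ha', hik] using hab i hi) x' hx'mem
      have hsum : ∑ i ∈ Finset.univ.erase j, ∑ l ∈ Finset.Ico (a i) (b i),
            R.coupling i l j * |R.step i l| =
          R.coupling k (a k) j * |R.step k (a k)| +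
          ∑ i ∈ Finset.univ.erase j, ∑ l ∈ Finset.Ico (a' i) (b i),
            R.coupling i l j * |R.step i l| := by
        rw [← Finset.add_sum_erase _ _ hkmem, ← Finset.add_sum_erase (a := k) _ _ hkmem,
          Finset.sum_eq_sum_Ico_succ_bot hkab,
          Finset.sum_congr (s₁ := (Finset.univ.erase j).erase k)
            (f := fun i => ∑ l ∈ Finset.Ico (a' i) (b i), R.coupling i l j * |R.step i l|) rfl
            fun i hi => by rw [hother i hi], ha', Function.update_self]
        ring
      rw [hsum]
      calc |partialDeriv j φ x - partialDeriv j φ (R.pos t)|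
          ≤ |partialDeriv j φ x - partialDeriv j φ x'| +
            |partialDeriv j φ x' - partialDeriv j φ (R.pos t)| := abs_sub_le _ _ _
        _ ≤ _ := add_le_add hstep hIH
  exact main _ _ rfl (fun _ _ => le_rfl)
    (fun k _ => R.idx_mono k ((R.time_strictMono j).monotone (Nat.le_succ m))) x
    (R.box_subset_indexBox j _ _ _ hx)

/-- The charges `W k l j` of the `(l + 1)`-th update of core `k` to the next update of core `j`:
they are paid for by the energy of the former, and bound the gradient error of the latter. -/
structure IsCharge (εF εB : ℝ) (W : Fin n → ℕ → Fin n → ℝ) : Prop where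
  nonneg : ∀ k l j, 0 ≤ W k l j
  sum_le : ∀ k l, ∑ j, W k l j ≤ εF * R.energy k l
  sq_error_le : ∀ j m, ∀ x ∈ R.box j (R.time j m) (R.time j (m + 1)) (R.val j m),
    (partialDeriv j φ x - partialDeriv j φ (R.pos (R.time j (m + 1)))) ^ 2 ≤
      2 * εB * R.γ j m * ∑ k, ∑ l ∈ R.window k j m, W k l j

/-- Each error term `H |s|` is the geometric mean of `(H / ξ) Δ`, whose sum (A4) bounds by `2 εB γ`,
and of the charge `ξ H s² / Δ`. -/
theorem Controlled.exists_isCharge {R : AGDRun φ} {α εF εB : ℝ} {γbar : Fin n → ℝ}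
    (hR : R.Controlled α εF εB γbar) (hφ : TwiceDifferentiable φ) (hF : 0 < εF) (hB : 0 < εB) :
    ∃ W, R.IsCharge εF εB W := by
  obtain ⟨-, -, ξ, hξ, hfut, hpast⟩ := hR
  have hW0 : ∀ k l j, k ≠ j → 0 ≤ ξ k l j * R.coupling k l j * (R.step k l ^ 2 / R.dur k l) :=
    fun k l j hkj => mul_nonneg (mul_nonneg (hξ k l j hkj.symm).le (R.coupling_nonneg k l j))
      (div_nonneg (sq_nonneg _) (R.dur_pos k l).le)
  -- The diagonal is set to zero because `window j j m` contains core `j`'s own previous update when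
  -- `m > 0`.
  refine ⟨fun k l j => if k = j then 0 else
    ξ k l j * R.coupling k l j * (R.step k l ^ 2 / R.dur k l), ⟨?_, ?_, ?_⟩⟩
  · intro k l j
    split_ifs with h
    · exact le_rfl
    · exact hW0 k l j h
  · intro k l
    have hreal : ∑ j ∈ Finset.univ.erase k, ξ k l j * R.coupling k l j ≤ εF * R.γ k l := by
      have h := hfut k l
      have hne := ne_top_of_le_ne_top ENNReal.ofReal_ne_top h
      have h' := ENNReal.toReal_mono ENNReal.ofReal_ne_top h
      rw [ENNReal.toReal_ofReal (mul_pos hF (R.γ_pos k l)).le,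
        ENNReal.toReal_sum fun j hj => ENNReal.sum_ne_top.1 hne j hj] at h'
      refine le_trans (le_of_eq (Finset.sum_congr rfl fun j hj => ?_)) h'
      rw [ENNReal.toReal_mul, ENNReal.toReal_ofReal (hξ k l j (Finset.ne_of_mem_erase hj)).le]
      rfl
    rw [← Finset.add_sum_erase _ _ (Finset.mem_univ k), if_pos rfl, zero_add,
      Finset.sum_congr rfl fun j hj => if_neg (Finset.ne_of_mem_erase hj).symm, ← Finset.sum_mul]
    calc _ ≤ εF * R.γ k l * (R.step k l ^ 2 / R.dur k l) :=
          mul_le_mul_of_nonneg_right hreal (div_nonneg (sq_nonneg _) (R.dur_pos k l).le)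
      _ = _ := by rw [energy]; ring
  · intro j m x hx
    set H : Fin n → ℝ≥0∞ := fun k =>
      hessianSup φ k j (R.box j (R.time j m) (R.time j (m + 1)) (R.val j m)) with hH
    set Y : Fin n → ℝ≥0∞ := fun k =>
      ⨆ l : ℕ, ⨆ _ : R.time k (l + 1) ∈ Set.Ioo (R.time j m) (R.time j (m + 1)),
          ENNReal.ofReal (1 / ξ k l j) with hY
    have hsum := hpast j m
    change ∑ k ∈ Finset.univ.erase j, Y k * H k ≤ _ at hsum
    have hne := ne_top_of_le_ne_top ENNReal.ofReal_ne_top hsum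
    have hne' : ∀ k, k ≠ j → Y k * H k ≠ ∞ := fun k hk =>
      ENNReal.sum_ne_top.1 hne k (Finset.mem_erase.2 ⟨hk, Finset.mem_univ k⟩)
    have hYle : ∀ k, k ≠ j → ∀ l ∈ R.window k j m, ENNReal.ofReal (1 / ξ k l j) ≤ Y k :=
      fun k hk l hl => le_iSup₂_of_le (f := fun (l : ℕ)
        (_ : R.time k (l + 1) ∈ Set.Ioo (R.time j m) (R.time j (m + 1))) =>
          ENNReal.ofReal (1 / ξ k l j)) l
        ⟨R.time_lt_of_mem_window hk hl, (R.mem_window.1 hl).2⟩ le_rfl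
    -- An update in the window makes the weight `Y k` positive, so the finite sum in (A4) forces `H
    -- k` to be finite.
    have hHfin : ∀ k, k ≠ j → (R.window k j m).Nonempty → H k ≠ ∞ := by
      rintro k hk ⟨l, hl⟩ htop
      refine hne' k hk ?_
      rw [htop, ENNReal.mul_top]
      exact ((ENNReal.ofReal_pos.2 (one_div_pos.2 (hξ k l j hk.symm))).trans_le (hYle k hk l hl)).ne'
    have hcoup : ∀ k, k ≠ j → ∀ l ∈ R.window k j m,
        R.coupling k l j / ξ k l j ≤ (Y k * H k).toReal := by
      intro k hk l hl
      have h1 : ENNReal.ofReal (1 / ξ k l j) * hessianSup φ k j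
          (R.box j (R.time k (l + 1)) (R.time j (m + 1)) (R.val j m)) ≤ Y k * H k :=
        mul_le_mul' (hYle k hk l hl)
          (hessianSup_mono k j (R.box_mono_left j (R.mem_window.1 hl).1))
      have h2 := ENNReal.toReal_mono (hne' k hk) h1
      rw [ENNReal.toReal_mul, ENNReal.toReal_ofReal (one_div_pos.2 (hξ k l j hk.symm)).le,
        ← R.coupling_eq hk hl] at h2
      rwa [div_eq_mul_one_div, mul_comm]
    have hback : ∑ k ∈ Finset.univ.erase j, ∑ l ∈ R.window k j m,
        R.coupling k l j / ξ k l j * R.dur k l ≤ 2 * εB * R.γ j m := by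
      have h' := ENNReal.toReal_mono ENNReal.ofReal_ne_top hsum
      rw [ENNReal.toReal_ofReal (mul_pos hB (R.γ_pos j m)).le,
        ENNReal.toReal_sum fun k hk => hne' k (Finset.ne_of_mem_erase hk)] at h'
      calc _ ≤ ∑ k ∈ Finset.univ.erase j, (Y k * H k).toReal * 2 := by
            refine Finset.sum_le_sum fun k hk => ?_
            have hkj := Finset.ne_of_mem_erase hk
            calc _ ≤ ∑ l ∈ R.window k j m, (Y k * H k).toReal * R.dur k l :=
                  Finset.sum_le_sum fun l hl =>
                    mul_le_mul_of_nonneg_right (hcoup k hkj l hl) (R.dur_pos k l).le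
              _ = (Y k * H k).toReal * ∑ l ∈ R.window k j m, R.dur k l := by
                  rw [Finset.mul_sum]
              _ ≤ _ := mul_le_mul_of_nonneg_left (R.sum_dur_window_le k j m)
                  ENNReal.toReal_nonneg
        _ = (∑ k ∈ Finset.univ.erase j, (Y k * H k).toReal) * 2 := by rw [Finset.sum_mul]
        _ ≤ _ := by linarith
    have herr := R.abs_partialDeriv_sub_le hφ hHfin hx
    rw [Finset.sum_sigma'] at herr hback
    have hWsum : ∑ k, ∑ l ∈ R.window k j m, (if k = j then 0 else
        ξ k l j * R.coupling k l j * (R.step k l ^ 2 / R.dur k l)) =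
        ∑ p ∈ (Finset.univ.erase j).sigma fun k => R.window k j m,
          ξ p.1 p.2 j * R.coupling p.1 p.2 j * (R.step p.1 p.2 ^ 2 / R.dur p.1 p.2) := by
      rw [← Finset.sum_sigma' (Finset.univ.erase j) (fun k => R.window k j m)
          (fun k l => ξ k l j * R.coupling k l j * (R.step k l ^ 2 / R.dur k l)),
        ← Finset.add_sum_erase _ _ (Finset.mem_univ j)]
      simp only [if_true, Finset.sum_const_zero, zero_add]
      exact Finset.sum_congr rfl fun k hk => Finset.sum_congr rfl fun l _ =>
        if_neg (Finset.ne_of_mem_erase hk)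
    rw [hWsum]
    have hcs := Finset.sum_sq_le_sum_mul_sum_of_sq_le_mul
      ((Finset.univ.erase j).sigma fun k => R.window k j m)
      (r := fun p => R.coupling p.1 p.2 j * |R.step p.1 p.2|)
      (f := fun p => R.coupling p.1 p.2 j / ξ p.1 p.2 j * R.dur p.1 p.2)
      (g := fun p => ξ p.1 p.2 j * R.coupling p.1 p.2 j * (R.step p.1 p.2 ^ 2 / R.dur p.1 p.2))
      (fun p hp => mul_nonneg (div_nonneg (R.coupling_nonneg _ _ _)
        (hξ _ _ _ (Finset.ne_of_mem_erase (Finset.mem_sigma.1 hp).1).symm).le) (R.dur_pos _ _).le)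
      (fun p hp => hW0 _ _ _ (Finset.ne_of_mem_erase (Finset.mem_sigma.1 hp).1))
      (fun p hp => by
        have h1 := (hξ p.1 p.2 j (Finset.ne_of_mem_erase (Finset.mem_sigma.1 hp).1).symm).ne'
        have h2 := (R.dur_pos p.1 p.2).ne'
        rw [mul_pow, sq_abs]
        refine le_of_eq ?_
        field_simp)
    calc _ = |partialDeriv j φ x - partialDeriv j φ (R.pos (R.time j (m + 1)))| ^ 2 :=
          (sq_abs _).symm
      _ ≤ _ := pow_le_pow_left₀ (abs_nonneg _) herr 2
      _ ≤ _ := hcs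
      _ ≤ _ := mul_le_mul_of_nonneg_right hback (Finset.sum_nonneg fun p hp =>
          hW0 _ _ _ (Finset.ne_of_mem_erase (Finset.mem_sigma.1 hp).1))

end AGDRun

/-! ### Charge accounting and the potential. -/

namespace AGDRun

variable (R : AGDRun φ) {W : Fin n → ℕ → Fin n → ℝ} {α εF εB : ℝ} {γbar : Fin n → ℝ}

/-- The energy of the updates made at times in `[a, b)`. -/
noncomputable def totalEnergy (a b : ℝ) : ℝ :=
  ∑ k, ∑ l ∈ Finset.Ico (R.idx k a) (R.idx k b), R.energy k l

theorem totalEnergy_nonneg (a b : ℝ) : 0 ≤ R.totalEnergy a b :=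
  Finset.sum_nonneg fun k _ => Finset.sum_nonneg fun l _ => R.energy_nonneg k l

theorem totalEnergy_mono {a b a' b' : ℝ} (ha : a' ≤ a) (hb : b ≤ b') :
    R.totalEnergy a b ≤ R.totalEnergy a' b' :=
  Finset.sum_le_sum fun k _ => Finset.sum_le_sum_of_subset_of_nonneg
    (Finset.Ico_subset_Ico (R.idx_mono k ha) (R.idx_mono k hb)) fun l _ _ => R.energy_nonneg k l

/-- The charges received by the `(m + 1)`-th update of core `j`. -/
noncomputable def received (W : Fin n → ℕ → Fin n → ℝ) (j : Fin n) (m : ℕ) : ℝ :=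
  ∑ k, ∑ l ∈ R.window k j m, W k l j

theorem sum_received (W : Fin n → ℕ → Fin n → ℝ) {T₀ T₁ : ℝ} (h : T₀ ≤ T₁) :
    ∑ j, ∑ m ∈ Finset.Ico (R.idx j T₀) (R.idx j T₁), R.received W j m =
      ∑ j, ∑ k, ∑ l ∈ Finset.Ico (R.idx k (R.time j (R.idx j T₀)))
        (R.idx k (R.time j (R.idx j T₁))), W k l j := by
  refine Finset.sum_congr rfl fun j _ => ?_
  simp only [received]
  rw [Finset.sum_comm]
  exact Finset.sum_congr rfl fun k _ => R.sum_Ico_sum_window k j _ (R.idx_mono j h)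

variable {R}

theorem IsCharge.received_nonneg (hW : R.IsCharge εF εB W) (j : Fin n) (m : ℕ) :
    0 ≤ R.received W j m :=
  Finset.sum_nonneg fun k _ => Finset.sum_nonneg fun l _ => hW.nonneg k l j

theorem IsCharge.sum_charge_le (hW : R.IsCharge εF εB W) (a b : ℝ) :
    ∑ k, ∑ l ∈ Finset.Ico (R.idx k a) (R.idx k b), ∑ j, W k l j ≤ εF * R.totalEnergy a b := by
  rw [totalEnergy, Finset.mul_sum]
  refine Finset.sum_le_sum fun k _ => ?_
  rw [Finset.mul_sum]
  exact Finset.sum_le_sum fun l _ => hW.sum_le k l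

/-- The windows of a core are consecutive, so each charge is received at most once, and only after
it was issued. -/
theorem IsCharge.sum_received_le_sum_charge (hW : R.IsCharge εF εB W) {T₀ T₁ : ℝ} (h : T₀ ≤ T₁)
    (h₁ : 0 ≤ T₁) {a : ℝ} (ha : ∀ k j : Fin n, R.idx k a ≤ R.idx k (R.time j (R.idx j T₀))) :
    ∑ j, ∑ m ∈ Finset.Ico (R.idx j T₀) (R.idx j T₁), R.received W j m ≤
      ∑ k, ∑ l ∈ Finset.Ico (R.idx k a) (R.idx k T₁), ∑ j, W k l j := by
  rw [R.sum_received W h, Finset.sum_comm]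
  refine Finset.sum_le_sum fun k _ => ?_
  rw [Finset.sum_comm]
  refine Finset.sum_le_sum fun j _ => Finset.sum_le_sum_of_subset_of_nonneg
    (Finset.Ico_subset_Ico (ha k j) (R.idx_mono k (R.time_idx_le j h₁))) fun l _ _ => hW.nonneg k l j

theorem IsCharge.sum_received_le (hW : R.IsCharge εF εB W) {T₀ T₁ : ℝ} (h : T₀ ≤ T₁)
    (h₁ : 0 ≤ T₁) :
    ∑ j, ∑ m ∈ Finset.Ico (R.idx j T₀) (R.idx j T₁), R.received W j m ≤
      εF * R.totalEnergy (T₀ - 1) T₁ :=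
  (hW.sum_received_le_sum_charge h h₁ fun k j => R.idx_mono k (R.sub_one_le_time_idx j T₀)).trans
    (hW.sum_charge_le _ _)

/-- Every core has completed a cycle at or after `T - 1` (or `T - 1` precedes the start), so only
charges issued in the last unit of time can be outstanding. -/
theorem IsCharge.sum_charge_le_sum_received (hW : R.IsCharge εF εB W) {T : ℝ} (hT : 0 ≤ T) :
    ∑ k, ∑ l ∈ Finset.range (R.idx k T), ∑ j, W k l j ≤
      ∑ j, ∑ m ∈ Finset.range (R.idx j T), R.received W j m + εF * R.totalEnergy (T - 1) T := by
  have h1 := R.sum_received W hT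
  simp only [R.idx_of_nonpos _ le_rfl, R.time_zero, ← Finset.range_eq_Ico] at h1
  have h2 : ∑ k, ∑ l ∈ Finset.range (R.idx k (T - 1)), ∑ j, W k l j ≤
      ∑ j, ∑ k, ∑ l ∈ Finset.range (R.idx k (R.time j (R.idx j T))), W k l j := by
    rw [Finset.sum_comm (s := (Finset.univ : Finset (Fin n)))
      (f := fun j k => ∑ l ∈ Finset.range (R.idx k (R.time j (R.idx j T))), W k l j)]
    refine Finset.sum_le_sum fun k _ => ?_
    rw [Finset.sum_comm]
    exact Finset.sum_le_sum fun j _ => Finset.sum_le_sum_of_subset_of_nonneg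
      (Finset.range_subset_range.2 (R.idx_mono k (R.sub_one_le_time_idx j T)))
      fun l _ _ => hW.nonneg k l j
  have h3 : ∑ k, ∑ l ∈ Finset.range (R.idx k T), ∑ j, W k l j =
      ∑ k, ∑ l ∈ Finset.range (R.idx k (T - 1)), ∑ j, W k l j +
      ∑ k, ∑ l ∈ Finset.Ico (R.idx k (T - 1)) (R.idx k T), ∑ j, W k l j := by
    rw [← Finset.sum_add_distrib]
    exact Finset.sum_congr rfl fun k _ =>
      (Finset.sum_range_add_sum_Ico _ (R.idx_mono k (by linarith))).symm
  rw [h3, h1]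
  exact add_le_add h2 (hW.sum_charge_le _ _)

theorem IsCharge.sum_received_le_sum_charge_zero (hW : R.IsCharge εF εB W) {T : ℝ} (hT : 0 ≤ T) :
    ∑ j, ∑ m ∈ Finset.range (R.idx j T), R.received W j m ≤
      ∑ k, ∑ l ∈ Finset.range (R.idx k T), ∑ j, W k l j := by
  have := hW.sum_received_le_sum_charge hT hT (a := 0)
    fun k j => R.idx_mono k (R.time_nonneg j _)
  simpa only [R.idx_of_nonpos _ le_rfl, ← Finset.range_eq_Ico] using this

variable (R)

/-- The change of the potential caused by the `(m + 1)`-th update of core `j`. -/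
noncomputable def potentialStep (W : Fin n → ℕ → Fin n → ℝ) (j : Fin n) (m : ℕ) : ℝ :=
  φ (R.posAfter j m) - φ (R.pos (R.time j (m + 1))) +
    1 / 2 * (∑ k, W j m k - R.received W j m)

/-- The objective together with the charges that are still to be received. -/
noncomputable def potential (W : Fin n → ℕ → Fin n → ℝ) (T : ℝ) : ℝ :=
  φ (R.pos 0) + ∑ j, ∑ m ∈ Finset.range (R.idx j T), R.potentialStep W j m

theorem potential_of_nonpos (W : Fin n → ℕ → Fin n → ℝ) {T : ℝ} (hT : T ≤ 0) :
    R.potential W T = φ (R.pos 0) := by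
  simp [potential, R.idx_of_nonpos _ hT]

theorem potential_eq (W : Fin n → ℕ → Fin n → ℝ) (T : ℝ) :
    R.potential W T = φ (R.pos T) +
      1 / 2 * (∑ k, ∑ l ∈ Finset.range (R.idx k T), ∑ j, W k l j -
        ∑ j, ∑ m ∈ Finset.range (R.idx j T), R.received W j m) := by
  rw [R.apply_pos_eq_add_sum φ T]
  simp only [potential, potentialStep, Finset.sum_add_distrib, Finset.sum_sub_distrib,
    ← Finset.mul_sum]
  ring

theorem partialDeriv_dated (j : Fin n) (m : ℕ) :
    partialDeriv j φ (R.dated j m) * R.dur j m = -(R.γ j m * R.step j m) := by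
  have h := R.update j m
  have hγ := (R.γ_pos j m).ne'
  rw [step, h, Timeline.dur]
  field_simp
  ring

variable {R}

theorem IsCharge.le_potential (hW : R.IsCharge εF εB W) {T : ℝ} (hT : 0 ≤ T) :
    φ (R.pos T) ≤ R.potential W T := by
  rw [potential_eq]
  linarith [hW.sum_received_le_sum_charge_zero hT]

theorem IsCharge.potential_le (hW : R.IsCharge εF εB W) {T : ℝ} (hT : 0 ≤ T) :
    R.potential W T ≤ φ (R.pos T) + εF / 2 * R.totalEnergy (T - 1) T := by
  rw [potential_eq]
  linarith [hW.sum_charge_le_sum_received hT]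

/-- Of the ideal gain `E`, the curvature term of (A1) costs `E / α`, the gradient error costs `εB E
+ V / 2`, and issuing new charges costs at most `εF E / 2`. Receiving the charges `V` refunds
exactly `V / 2`. -/
theorem Controlled.potentialStep_le (hR : R.Controlled α εF εB γbar) (hα : 2 ≤ α) (hB : 0 < εB)
    (hW : R.IsCharge εF εB W) (j : Fin n) (m : ℕ) :
    R.potentialStep W j m ≤ -((1 - 1 / α - εB - εF / 2) * R.energy j m) := by
  have hA1 := hR.2.1 j m (R.posAfter j m) (fun k hk => R.posAfter_of_ne hk m)
    (by rw [R.posAfter_self]; exact Set.right_mem_uIcc)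
  rw [R.posAfter_self] at hA1
  change _ - partialDeriv j φ (R.pos (R.time j (m + 1))) * R.step j m ≤
    _ * R.step j m ^ 2 at hA1
  have herr := hW.sq_error_le j m _ (R.dated_mem j m)
  have hdat := R.partialDeriv_dated j m
  have hWle := hW.sum_le j m
  have hV := hW.received_nonneg j m
  change _ ≤ 2 * εB * R.γ j m * R.received W j m at herr
  have hE : R.energy j m * R.dur j m = R.γ j m * R.step j m ^ 2 :=
    div_mul_cancel₀ _ (R.dur_pos j m).ne'
  have hE0 := R.energy_nonneg j m
  have hd := R.dur_pos j m
  have hd1 := R.dur_le_one j m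
  have hγ := R.γ_pos j m
  rw [potentialStep]
  generalize φ (R.posAfter j m) - φ (R.pos (R.time j (m + 1))) = dφ at *
  generalize partialDeriv j φ (R.dated j m) = g' at *
  generalize partialDeriv j φ (R.pos (R.time j (m + 1))) = g at *
  generalize R.received W j m = V at *
  generalize ∑ k, W j m k = w at *
  generalize R.energy j m = E at *
  generalize R.dur j m = d at *
  generalize R.step j m = s at *
  generalize R.γ j m = γ at *
  have hsE : γ * s ^ 2 ≤ E := by rw [← hE]; exact mul_le_of_le_one_right hE0 hd1
  have hg's : g' * s = -E := by
    have : (g' * s + E) * d = 0 := by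
      linear_combination s * hdat + hE
    rcases mul_eq_zero.1 this with h | h
    · linarith
    · exact absurd h hd.ne'
  -- The squared left side is at most `2 εB V E`; then AM–GM.
  have hcross : (g - g') * s ≤ 1 / 2 * V + εB * E := by
    have hsq : ((g - g') * s) ^ 2 ≤ (1 / 2 * V + εB * E) ^ 2 := by
      calc ((g - g') * s) ^ 2 = (g' - g) ^ 2 * s ^ 2 := by ring
        _ ≤ 2 * εB * γ * V * s ^ 2 := mul_le_mul_of_nonneg_right herr (sq_nonneg s)
        _ = 2 * εB * V * (γ * s ^ 2) := by ring
        _ ≤ 2 * εB * V * E := mul_le_mul_of_nonneg_left hsE (by positivity)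
        _ ≤ _ := by nlinarith [sq_nonneg (1 / 2 * V - εB * E)]
    exact le_of_abs_le (abs_le_of_sq_le_sq hsq (by positivity))
  have hαE : γ / α * s ^ 2 ≤ 1 / α * E := by
    have : 0 < α := by linarith
    calc γ / α * s ^ 2 = 1 / α * (γ * s ^ 2) := by ring
      _ ≤ _ := mul_le_mul_of_nonneg_left hsE (by positivity)
  nlinarith

theorem Controlled.potential_add_le (hR : R.Controlled α εF εB γbar) (hα : 2 ≤ α) (hB : 0 < εB)
    (hW : R.IsCharge εF εB W) {a b : ℝ} (hab : a ≤ b) :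
    R.potential W b + (1 - 1 / α - εB - εF / 2) * R.totalEnergy a b ≤ R.potential W a := by
  have h : ∑ j, ∑ m ∈ Finset.range (R.idx j b), R.potentialStep W j m =
      ∑ j, ∑ m ∈ Finset.range (R.idx j a), R.potentialStep W j m +
      ∑ j, ∑ m ∈ Finset.Ico (R.idx j a) (R.idx j b), R.potentialStep W j m := by
    rw [← Finset.sum_add_distrib]
    exact Finset.sum_congr rfl fun k _ =>
      (Finset.sum_range_add_sum_Ico _ (R.idx_mono k hab)).symm
  have h2 : ∑ j, ∑ m ∈ Finset.Ico (R.idx j a) (R.idx j b), R.potentialStep W j m ≤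
      -((1 - 1 / α - εB - εF / 2) * R.totalEnergy a b) := by
    rw [totalEnergy, Finset.mul_sum, ← Finset.sum_neg_distrib]
    refine Finset.sum_le_sum fun j _ => ?_
    rw [Finset.mul_sum, ← Finset.sum_neg_distrib]
    exact Finset.sum_le_sum fun m _ => hR.potentialStep_le hα hB hW j m
  rw [potential, potential, h]
  linarith

/-! ### The gradient is controlled by the energy. -/

/-- The gradient at time `s` is bounded by quantities of the cycles that contain `s`. -/
theorem IsCharge.sq_partialDeriv_pos_le (hW : R.IsCharge εF εB W) {s : ℝ} (hs : 0 ≤ s)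
    (j : Fin n) :
    partialDeriv j φ (R.pos s) ^ 2 * R.dur j (R.idx j s) ≤
      R.γ j (R.idx j s) * (2 * R.energy j (R.idx j s) + 16 * εB * R.received W j (R.idx j s)) := by
  have hmem := R.pos_mem_box j (t := s) (t₁ := R.time j (R.idx j s))
    (t₂ := R.time j (R.idx j s + 1)) ⟨R.time_idx_le j hs, R.le_time_idx_succ j s⟩
  rw [R.pos_apply] at hmem
  have h1 := hW.sq_error_le j _ _ hmem
  have h2 := hW.sq_error_le j _ _ (R.dated_mem j (R.idx j s))
  change _ ≤ 2 * εB * R.γ j _ * R.received W j _ at h1 h2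
  have h3 := R.partialDeriv_dated j (R.idx j s)
  have hE : R.energy j (R.idx j s) * R.dur j (R.idx j s) =
      R.γ j (R.idx j s) * R.step j (R.idx j s) ^ 2 :=
    div_mul_cancel₀ _ (R.dur_pos j _).ne'
  have hd := R.dur_pos j (R.idx j s)
  have hd1 := R.dur_le_one j (R.idx j s)
  generalize R.idx j s = m at *
  generalize partialDeriv j φ (R.dated j m) = g' at *
  generalize partialDeriv j φ (R.pos s) = g at *
  generalize partialDeriv j φ (R.pos (R.time j (m + 1))) = g₀ at *
  have hg' : g' ^ 2 * R.dur j m = R.γ j m * R.energy j m := by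
    have : (g' ^ 2 * R.dur j m - R.γ j m * R.energy j m) * R.dur j m = 0 := by
      linear_combination (g' * R.dur j m - R.γ j m * R.step j m) * h3 - R.γ j m * hE
    rcases mul_eq_zero.1 this with h | h
    · linarith
    · exact absurd h hd.ne'
  -- Both `p^s` and the dated point lie in the box of the current cycle, so both are compared with
  -- the gradient `g₀` at the end of the cycle.
  have hsq : g ^ 2 ≤ 2 * g' ^ 2 + 4 * ((g - g₀) ^ 2 + (g' - g₀) ^ 2) := by
    nlinarith [sq_nonneg ((g - g₀) + (g' - g₀)), sq_nonneg (g - 2 * g')]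
  have hX : 0 ≤ 2 * εB * R.γ j m * R.received W j m := (sq_nonneg _).trans h1
  calc g ^ 2 * R.dur j m
      ≤ (2 * g' ^ 2 + 8 * (2 * εB * R.γ j m * R.received W j m)) * R.dur j m :=
        mul_le_mul_of_nonneg_right (by linarith) hd.le
    _ = 2 * (g' ^ 2 * R.dur j m) + 8 * (2 * εB * R.γ j m * R.received W j m) * R.dur j m := by ring
    _ ≤ 2 * (R.γ j m * R.energy j m) + 8 * (2 * εB * R.γ j m * R.received W j m) := by
        rw [hg']
        have := mul_le_of_le_one_right (a := 8 * (2 * εB * R.γ j m * R.received W j m))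
          (by linarith) hd1
        linarith
    _ = _ := by ring

open MeasureTheory in
/-- Averaging over a unit of time. -/
theorem _root_.Timeline.exists_sum_idx_le (R : Timeline n) {A : Fin n → ℕ → ℝ}
    (hA : ∀ j m, 0 ≤ A j m) {T : ℝ} (hT : 0 ≤ T) :
    ∃ s ∈ Set.Ioc T (T + 1), ∑ j, A j (R.idx j s) / R.dur j (R.idx j s) ≤
      ∑ j, ∑ m ∈ Finset.Ico (R.idx j T) (R.idx j (T + 2)), A j m := by
  set g : ℝ → ℝ := fun s => ∑ j, ∑ m ∈ Finset.Ico (R.idx j T) (R.idx j (T + 2)),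
    (Set.Ioc (R.time j m) (R.time j (m + 1))).indicator (fun _ => A j m / R.dur j m) s with hg
  have hA' : ∀ j m, 0 ≤ A j m / R.dur j m := fun j m => div_nonneg (hA j m) (R.dur_pos j m).le
  have hint : ∀ j m, IntegrableOn ((Set.Ioc (R.time j m) (R.time j (m + 1))).indicator
      (fun _ => A j m / R.dur j m)) (Set.Ioc T (T + 1)) := fun j m =>
    (integrableOn_const (by simp)).indicator measurableSet_Ioc
  have hgint : IntegrableOn g (Set.Ioc T (T + 1)) :=
    integrable_finsetSum _ fun j _ => integrable_finsetSum _ fun m _ => hint j m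
  obtain ⟨s, hs, hle⟩ := exists_le_setAverage (μ := volume) (s := Set.Ioc T (T + 1)) (f := g)
    (by simp) (by simp) hgint
  refine ⟨s, hs, ?_⟩
  have hs0 : 0 < s := hT.trans_lt hs.1
  have h1 : ∑ j, A j (R.idx j s) / R.dur j (R.idx j s) ≤ g s := by
    refine Finset.sum_le_sum fun j _ => ?_
    -- A cycle containing `s ≤ T + 1` ends before `T + 2`.
    have hmem : R.idx j s ∈ Finset.Ico (R.idx j T) (R.idx j (T + 2)) := by
      refine Finset.mem_Ico.2 ⟨R.idx_mono j hs.1.le, R.lt_idx_iff.2 ?_⟩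
      linarith [R.gap_le_one j (R.idx j s), R.time_idx_lt j hs0, hs.2]
    refine le_trans (le_of_eq ?_) (Finset.single_le_sum (fun m _ =>
      Set.indicator_nonneg (fun _ _ => hA' j m) s) hmem)
    rw [Set.indicator_of_mem]
    exact ⟨R.time_idx_lt j hs0, R.le_time_idx_succ j s⟩
  have h2 : ⨍ x in Set.Ioc T (T + 1), g x ≤
      ∑ j, ∑ m ∈ Finset.Ico (R.idx j T) (R.idx j (T + 2)), A j m := by
    have hvol : volume.real (Set.Ioc T (T + 1)) = 1 := by simp
    rw [setAverage_eq, hvol, inv_one, one_smul, hg, integral_finsetSum _ fun j _ =>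
      integrable_finsetSum _ fun m _ => hint j m]
    refine Finset.sum_le_sum fun j _ => ?_
    rw [integral_finsetSum _ fun m _ => hint j m]
    refine Finset.sum_le_sum fun m _ => ?_
    -- The weight `1 / dur` cancels the length of the cycle, so however short the cycle is, it
    -- contributes at most `A j m`.
    rw [setIntegral_indicator measurableSet_Ioc, setIntegral_const, smul_eq_mul]
    calc _ ≤ R.dur j m * (A j m / R.dur j m) := by
          refine mul_le_mul_of_nonneg_right ?_ (hA' j m)
          refine (measureReal_mono (Set.inter_subset_right) (by simp)).trans ?_
          rw [Real.volume_real_Ioc_of_le (R.time_strictMono j m.lt_succ_self).le]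
          exact le_rfl
      _ = A j m := mul_div_cancel₀ _ (R.dur_pos j m).ne'
  exact h1.trans (hle.trans h2)

/-- At some time in each unit interval the gradient is bounded by the energy of nearby updates. -/
theorem Controlled.exists_sum_sq_partialDeriv_le (hR : R.Controlled α εF εB γbar)
    (hB : 0 < εB) (hFB : 16 * (εF * εB) ≤ 1) (hW : R.IsCharge εF εB W) {T : ℝ} (hT : 0 ≤ T) :
    ∃ s ∈ Set.Ioc T (T + 1), ∑ j, partialDeriv j φ (R.pos s) ^ 2 ≤
      3 * (⨆ j, γbar j) * R.totalEnergy (T - 1) (T + 2) := by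
  set G := ⨆ j, γbar j with hG
  have hγG : ∀ j m, R.γ j m ≤ G := fun j m =>
    (hR.1 j m).trans (le_ciSup (Set.finite_range γbar).bddAbove j)
  have hG0 : 0 ≤ G := Real.iSup_nonneg fun j => (R.γ_pos j 0).le.trans (hR.1 j 0)
  have hZ : ∀ j m, 0 ≤ 2 * R.energy j m + 16 * εB * R.received W j m := fun j m =>
    add_nonneg (mul_nonneg zero_le_two (R.energy_nonneg j m))
      (mul_nonneg (by positivity) (hW.received_nonneg j m))
  obtain ⟨s, hs, hle⟩ := R.exists_sum_idx_le (A := fun j m =>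
    G * (2 * R.energy j m + 16 * εB * R.received W j m)) (fun j m => mul_nonneg hG0 (hZ j m)) hT
  refine ⟨s, hs, ?_⟩
  calc ∑ j, partialDeriv j φ (R.pos s) ^ 2 ≤ _ := Finset.sum_le_sum fun j _ => by
        rw [le_div_iff₀ (R.dur_pos j _)]
        exact (hW.sq_partialDeriv_pos_le (hT.trans hs.1.le) j).trans
          (mul_le_mul_of_nonneg_right (hγG j _) (hZ j _))
    _ ≤ _ := hle
    _ = G * (2 * R.totalEnergy T (T + 2) + 16 * εB *
        ∑ j, ∑ m ∈ Finset.Ico (R.idx j T) (R.idx j (T + 2)), R.received W j m) := by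
        simp only [totalEnergy, mul_add, Finset.mul_sum, Finset.sum_add_distrib]
    _ ≤ G * (2 * R.totalEnergy (T - 1) (T + 2) + 1 * R.totalEnergy (T - 1) (T + 2)) := by
        refine mul_le_mul_of_nonneg_left (add_le_add ?_ ?_) hG0
        · exact mul_le_mul_of_nonneg_left (R.totalEnergy_mono (by linarith) le_rfl) zero_le_two
        · calc _ ≤ 16 * εB * (εF * R.totalEnergy (T - 1) (T + 2)) :=
                mul_le_mul_of_nonneg_left (hW.sum_received_le (by linarith) (by linarith))
                  (by positivity)
            _ = 16 * (εF * εB) * R.totalEnergy (T - 1) (T + 2) := by ring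
            _ ≤ _ := mul_le_mul_of_nonneg_right hFB (R.totalEnergy_nonneg _ _)
    _ = _ := by ring

end AGDRun

/-! ### Decay of real sequences. -/

/-- A sequence whose decrements are at least proportional to `F (k + 1)` as long as `F ≥ M`
decays geometrically until it falls below `M`. -/
theorem le_max_of_decrement {F : ℕ → ℝ} {ν M : ℝ} (hν : 0 < ν) (hM : 0 < M)
    (h : ∀ k, ν * F (k + 1) * min M (F (k + 1)) ≤ M * (F k - F (k + 1))) (k : ℕ) :
    F k ≤ max M (F 0 / (1 + ν) ^ k) := by
  induction k with
  | zero => simp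
  | succ k ih =>
    rcases le_or_gt (F (k + 1)) M with hle | hgt
    · exact hle.trans (le_max_left _ _)
    · have hk := h k
      rw [min_eq_left hgt.le] at hk
      have hstep : F (k + 1) * (1 + ν) ≤ F k := by
        have : M * (F (k + 1) * (1 + ν)) ≤ M * F k := by linarith
        exact le_of_mul_le_mul_left this hM
      have hkM : M < F k := by nlinarith
      rcases le_max_iff.1 ih with h1 | h1
      · linarith
      · refine le_max_of_le_right ?_
        rw [pow_succ, ← div_div, le_div_iff₀ (by positivity)]
        exact hstep.trans h1

/-- A sequence whose decrements are at least proportional to `F (k + 1) ^ 2` decays at a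
harmonic rate. -/
theorem mul_le_of_decrement {F : ℕ → ℝ} {ν M : ℝ} (hν : 0 < ν) (hν1 : ν ≤ 1) (hM : 0 < M)
    (hF : ∀ k, 0 ≤ F k)
    (h : ∀ k, ν * F (k + 1) * min M (F (k + 1)) ≤ M * (F k - F (k + 1))) {k₀ : ℕ}
    (h₀ : F k₀ ≤ M) (i : ℕ) :
    F (k₀ + i) * (1 + ν / 2 * i) ≤ M := by
  have hanti : ∀ k, F (k + 1) ≤ F k := fun k => by
    have h1 : 0 ≤ M * (F k - F (k + 1)) :=
      le_trans (mul_nonneg (mul_nonneg hν.le (hF _)) (le_min hM.le (hF _))) (h k)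
    linarith [(mul_nonneg_iff_of_pos_left hM).1 h1]
  have hle : ∀ i, F (k₀ + i) ≤ M := fun i =>
    (antitone_nat_of_succ_le hanti (Nat.le_add_right k₀ i)).trans h₀
  induction i with
  | zero => simpa using h₀
  | succ i ih =>
    have hk := h (k₀ + i)
    have hx := hle (i + 1)
    have hx0 := hF (k₀ + (i + 1))
    rw [← add_assoc] at hx hx0 ⊢
    rw [min_eq_right hx] at hk
    push_cast
    generalize F (k₀ + i + 1) = x at *
    generalize F (k₀ + i) = y at *
    have hq : (1 : ℝ) ≤ 1 + ν / 2 * i := le_add_of_nonneg_right (by positivity)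
    have hrw : 1 + ν / 2 * ((i : ℝ) + 1) = (1 + ν / 2 * i) + ν / 2 := by ring
    rw [hrw]
    generalize 1 + ν / 2 * (i : ℝ) = q at *
    have h1 : (x * M + ν * x ^ 2) * q ≤ M * M := by nlinarith
    -- After multiplication by `M + ν x`, the part with `q` is `h1`, and the part with `ν / 2` is at
    -- most `M ν x` because `ν x ≤ M`.
    have h2 : x * (q + ν / 2) * (M + ν * x) ≤ M * (M + ν * x) := by
      have : ν * x ≤ M := by nlinarith
      nlinarith [mul_nonneg (mul_nonneg hν.le hx0) (sub_nonneg.2 this)]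
    exact le_of_mul_le_mul_right h2 (by positivity)

/-! ### Bounding `φ` by its gradient. -/

theorem ConvexOn.add_fderiv_le (hφ : ConvexOn ℝ Set.univ φ) (hd : Differentiable ℝ φ)
    (x y : EuclideanSpace ℝ (Fin n)) : φ x + fderiv ℝ φ x (y - x) ≤ φ y := by
  have hconv : ConvexOn ℝ Set.univ fun s : ℝ => φ (x + s • (y - x)) := by
    have := hφ.comp_affineMap (AffineMap.lineMap x y : ℝ →ᵃ[ℝ] EuclideanSpace ℝ (Fin n))
    refine this.congr fun s _ => ?_
    simp [AffineMap.lineMap_apply, add_comm]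
  have hder : HasDerivAt (fun s : ℝ => φ (x + s • (y - x))) (fderiv ℝ φ x (y - x)) 0 := by
    have h1 : HasDerivAt (fun s : ℝ => x + s • (y - x)) (y - x) 0 := by
      simpa using ((hasDerivAt_id (0 : ℝ)).smul_const (y - x)).const_add x
    have h2 : HasFDerivAt φ (fderiv ℝ φ x) (x + (0 : ℝ) • (y - x)) := by
      simpa using (hd x).hasFDerivAt
    exact h2.comp_hasDerivAt 0 h1
  have := hconv.le_slope_of_hasDerivAt (Set.mem_univ 0) (Set.mem_univ 1) one_pos hder
  simp only [slope_def_field, one_smul, zero_smul, add_zero, sub_zero, div_one,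
    add_sub_cancel] at this
  linarith

theorem sq_sub_le_sum_sq_mul_dist_sq (hφ : ConvexOn ℝ Set.univ φ) (hd : Differentiable ℝ φ)
    {x y : EuclideanSpace ℝ (Fin n)} (hxy : φ y ≤ φ x) :
    (φ x - φ y) ^ 2 ≤ (∑ j, partialDeriv j φ x ^ 2) * dist x y ^ 2 := by
  have h := hφ.add_fderiv_le hd x y
  rw [fderiv_apply_eq_sum] at h
  have h1 : φ x - φ y ≤ ∑ j, partialDeriv j φ x * (x j - y j) := by
    have : ∑ j, partialDeriv j φ x * (y - x) j = -∑ j, partialDeriv j φ x * (x j - y j) := by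
      rw [← Finset.sum_neg_distrib]
      exact Finset.sum_congr rfl fun j _ => by rw [PiLp.sub_apply]; ring
    linarith
  calc (φ x - φ y) ^ 2 ≤ (∑ j, partialDeriv j φ x * (x j - y j)) ^ 2 :=
        pow_le_pow_left₀ (sub_nonneg.2 hxy) h1 2
    _ ≤ (∑ j, partialDeriv j φ x ^ 2) * ∑ j, (x j - y j) ^ 2 :=
        Finset.sum_mul_sq_le_sq_mul_sq _ _ _
    _ = _ := by
        rw [dist_eq_norm, EuclideanSpace.real_norm_sq_eq]
        rfl

/-- The Polyak–Łojasiewicz inequality, by completing the square in each coordinate. -/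
theorem StronglyConvex.sub_le {c : ℝ} (hφ : StronglyConvex φ c) (hc : 0 < c)
    (x y : EuclideanSpace ℝ (Fin n)) :
    φ x - φ y ≤ (∑ j, partialDeriv j φ x ^ 2) / (2 * c) := by
  have h := hφ x y
  rw [EuclideanSpace.real_norm_sq_eq, Finset.mul_sum, add_assoc, ← Finset.sum_add_distrib] at h
  have : -((∑ j, partialDeriv j φ x ^ 2) / (2 * c)) ≤
      ∑ j, (partialDeriv j φ x * (y j - x j) + c / 2 * (y - x) j ^ 2) := by
    rw [Finset.sum_div, ← Finset.sum_neg_distrib]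
    refine Finset.sum_le_sum fun j _ => ?_
    rw [PiLp.sub_apply]
    have : partialDeriv j φ x * (y j - x j) + c / 2 * (y j - x j) ^ 2 +
        partialDeriv j φ x ^ 2 / (2 * c) =
        (partialDeriv j φ x + c * (y j - x j)) ^ 2 / (2 * c) := by
      field_simp
      ring
    have h2 : 0 ≤ (partialDeriv j φ x + c * (y j - x j)) ^ 2 / (2 * c) := by positivity
    linarith
  linarith

/-! ### Decrement of the potential over three time units. -/

namespace AGDRun

variable {R : AGDRun φ} {W : Fin n → ℕ → Fin n → ℝ} {α εF εB c : ℝ} {γbar : Fin n → ℝ}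
  {pstar : EuclideanSpace ℝ (Fin n)}

/-- Over three units of time, either the potential is bounded by the gradient at some
intermediate point, or it decreases substantially. -/
theorem Controlled.exists_potential_le (hR : R.Controlled α εF εB γbar) (hα : 2 ≤ α) (hF : 0 < εF)
    (hB : 0 < εB) (hsum : 1 / α + 2 * εB + 2 * εF < 1) (hW : R.IsCharge εF εB W) {T : ℝ}
    (hT : 0 ≤ T) :
    ∃ s S : ℝ, 0 ≤ s ∧ 0 ≤ S ∧ S = R.totalEnergy (T - 1) (T + 2) ∧
      ∑ j, partialDeriv j φ (R.pos s) ^ 2 ≤ 3 * (⨆ j, γbar j) * S ∧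
      R.potential W (T + 2) ≤ φ (R.pos s) + S ∧
      (1 - 1 / α - εB - εF / 2) * S ≤ R.potential W (T - 1) - R.potential W (T + 2) := by
  have hα0 : 0 < 1 / α := by positivity
  have hη : 0 < 1 - 1 / α - εB - εF / 2 := by linarith
  -- `16 εF εB ≤ 1` holds by AM–GM, since `εF + εB < 1 / 2`.
  obtain ⟨s, hs, hle⟩ := hR.exists_sum_sq_partialDeriv_le hB
    (by nlinarith [sq_nonneg (εF - εB)]) hW hT
  have hs0 : 0 ≤ s := hT.trans hs.1.le
  refine ⟨s, _, hs0, R.totalEnergy_nonneg _ _, rfl, hle, ?_, ?_⟩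
  · have h1 := hR.potential_add_le hα hB hW (a := s) (b := T + 2) (by linarith [hs.2])
    have h2 := hW.potential_le hs0
    have h3 : R.totalEnergy (s - 1) s ≤ R.totalEnergy (T - 1) (T + 2) :=
      R.totalEnergy_mono (by linarith [hs.1]) (by linarith [hs.2])
    have h4 := mul_nonneg hη.le (R.totalEnergy_nonneg s (T + 2))
    have h5 : εF / 2 * R.totalEnergy (s - 1) s ≤ 1 * R.totalEnergy (s - 1) s :=
      mul_le_mul_of_nonneg_right (by linarith) (R.totalEnergy_nonneg _ _)
    linarith
  · have := hR.potential_add_le hα hB hW (a := T - 1) (b := T + 2) (by linarith)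
    linarith

theorem Controlled.pos_le_pos_zero (hR : R.Controlled α εF εB γbar) (hα : 2 ≤ α) (hF : 0 < εF)
    (hB : 0 < εB) (hsum : 1 / α + 2 * εB + 2 * εF < 1) (hW : R.IsCharge εF εB W) {t : ℝ}
    (ht : 0 ≤ t) : φ (R.pos t) ≤ φ (R.pos 0) := by
  have h := hR.potential_add_le hα hB hW ht
  rw [R.potential_of_nonpos W le_rfl] at h
  have := mul_nonneg (show 0 ≤ 1 - 1 / α - εB - εF / 2 by linarith) (R.totalEnergy_nonneg 0 t)
  linarith [hW.le_potential ht]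

theorem Controlled.decrement_of_bounded (hR : R.Controlled α εF εB γbar) (hα : 2 ≤ α)
    (hF : 0 < εF) (hB : 0 < εB) (hsum : 1 / α + 2 * εB + 2 * εF < 1) (hW : R.IsCharge εF εB W)
    (hφ : ConvexOn ℝ Set.univ φ) (hd : Differentiable ℝ φ) (hmin : ∀ x, φ pstar ≤ φ x)
    (h0 : φ pstar = 0) (hbdd : Bornology.IsBounded {x | φ x ≤ 2 * φ (R.pos 0)}) {M : ℝ}
    (hM : M = Metric.diam {x | φ x ≤ 2 * φ (R.pos 0)} ^ 2 * ⨆ j, γbar j) {T : ℝ} (hT : 0 ≤ T) :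
    (1 - 1 / α - εB - εF / 2) / 12 * R.potential W (T + 2) * min M (R.potential W (T + 2)) ≤
      M * (R.potential W (T - 1) - R.potential W (T + 2)) := by
  obtain ⟨s, S, hs, hS, -, hgrad, hle, hdec⟩ := hR.exists_potential_le hα hF hB hsum hW hT
  set η := 1 - 1 / α - εB - εF / 2 with hη_def
  have hη : 0 < η := by linarith
  have hG : 0 ≤ ⨆ j, γbar j := Real.iSup_nonneg fun j => (R.γ_pos j 0).le.trans (hR.1 j 0)
  have hM0 : 0 ≤ M := by rw [hM]; positivity
  have hφ0 : ∀ x, 0 ≤ φ x := fun x => h0 ▸ hmin x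
  have hx0 : 0 ≤ R.potential W (T + 2) := (hφ0 _).trans (hW.le_potential (by linarith))
  have hdist : dist (R.pos s) pstar ≤ Metric.diam {x | φ x ≤ 2 * φ (R.pos 0)} := by
    refine Metric.dist_le_diam_of_mem hbdd ?_ ?_
    · change φ _ ≤ _
      linarith [hR.pos_le_pos_zero hα hF hB hsum hW hs, hφ0 (R.pos 0)]
    · change φ _ ≤ _
      linarith [hφ0 (R.pos 0)]
  have hsq : φ (R.pos s) ^ 2 ≤ 3 * M * S := by
    have h1 := sq_sub_le_sum_sq_mul_dist_sq hφ hd (hmin (R.pos s))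
    rw [h0, sub_zero] at h1
    calc _ ≤ _ := h1
      _ ≤ (3 * (⨆ j, γbar j) * S) * Metric.diam {x | φ x ≤ 2 * φ (R.pos 0)} ^ 2 :=
        mul_le_mul hgrad (pow_le_pow_left₀ dist_nonneg hdist 2) (by positivity) (by positivity)
      _ = _ := by rw [hM]; ring
  have hf := hφ0 (R.pos s)
  generalize φ (R.pos s) = f at *
  generalize R.potential W (T + 2) = x at *
  generalize R.potential W (T - 1) - x = d at *
  have hMd : M * (η * S) ≤ M * d := mul_le_mul_of_nonneg_left hdec hM0
  -- As `x ≤ f + S`, either `x ≤ 2 S`, or `x < 2 f` and then `x² ≤ 4 f² ≤ 12 M S`; this is the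
  -- source of the 12.
  rcases le_or_gt x (2 * S) with hxS | hxS
  · calc η / 12 * x * min M x ≤ η / 12 * x * M :=
          mul_le_mul_of_nonneg_left (min_le_left _ _) (by positivity)
      _ ≤ η / 12 * (2 * S) * M :=
          mul_le_mul_of_nonneg_right (mul_le_mul_of_nonneg_left hxS (by positivity)) hM0
      _ ≤ M * (η * S) := by
          have : 0 ≤ M * (η * S) := by positivity
          linarith
      _ ≤ _ := hMd
  · have hxf : x ^ 2 ≤ (2 * f) ^ 2 := pow_le_pow_left₀ hx0 (by linarith) 2
    calc η / 12 * x * min M x ≤ η / 12 * x * x :=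
          mul_le_mul_of_nonneg_left (min_le_right _ _) (by positivity)
      _ = η / 12 * x ^ 2 := by ring
      _ ≤ η / 12 * (12 * M * S) := mul_le_mul_of_nonneg_left (by nlinarith) (by positivity)
      _ = M * (η * S) := by ring
      _ ≤ _ := hMd

/-- Along any nonzero step, strong convexity and (A1) squeeze the curvature: `c / 2 ≤ γ / α ≤ γ /
2`. If all steps vanish there is no energy, so the gradient is zero at the initial point, which is
then a minimum, against `hpos`. -/
theorem Controlled.le_of_stronglyConvex (hR : R.Controlled α εF εB γbar) (hα : 2 ≤ α)
    (hF : 0 < εF) (hB : 0 < εB) (hsum : 1 / α + 2 * εB + 2 * εF < 1) (hW : R.IsCharge εF εB W)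
    (h0 : φ pstar = 0) (hc : 0 < c) (hsc : StronglyConvex φ c) (hpos : 0 < φ (R.pos 0)) :
    c ≤ ⨆ j, γbar j := by
  by_cases hall : ∀ j m, R.step j m = 0
  · exfalso
    have hval : ∀ j m, R.val j m = R.val j 0 := by
      intro j m
      induction m with
      | zero => rfl
      | succ m ih => rw [← ih]; exact sub_eq_zero.1 (hall j m)
    obtain ⟨s, S, -, -, hSeq, hgrad, -, -⟩ := hR.exists_potential_le hα hF hB hsum hW le_rfl
    have hS : S = 0 := by simp [hSeq, totalEnergy, energy, hall]
    have hs : R.pos s = R.pos 0 := by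
      ext k
      rw [R.pos_apply, R.pos_apply, hval k (R.idx k s), hval k (R.idx k 0)]
    have h1 := hsc.sub_le hc (R.pos s) pstar
    rw [hS, mul_zero] at hgrad
    have h2 := div_nonpos_of_nonpos_of_nonneg hgrad (show 0 ≤ 2 * c by positivity)
    rw [hs, h0] at h1
    rw [hs] at h2
    linarith
  · push Not at hall
    obtain ⟨j, m, hjm⟩ := hall
    have hA1 := hR.2.1 j m (R.posAfter j m) (fun k hk => R.posAfter_of_ne hk m)
      (by rw [R.posAfter_self]; exact Set.right_mem_uIcc)
    have hcv := hsc (R.pos (R.time j (m + 1))) (R.posAfter j m)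
    have hposj : R.pos (R.time j (m + 1)) j = R.val j m := by
      rw [R.pos_apply, R.idx_time_succ]
    rw [EuclideanSpace.real_norm_sq_eq, Finset.sum_eq_single j, Finset.sum_eq_single j,
      PiLp.sub_apply, R.posAfter_self, hposj] at hcv
    · rw [R.posAfter_self] at hA1
      have hsq : 0 < R.step j m ^ 2 := by positivity
      change _ ≤ R.γ j m / α * R.step j m ^ 2 at hA1
      change _ + c / 2 * R.step j m ^ 2 ≤ _ at hcv
      have h1 : c / 2 ≤ R.γ j m / α := by
        refine le_of_mul_le_mul_right ?_ hsq
        linarith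
      have h2 : R.γ j m / α ≤ R.γ j m / 2 :=
        div_le_div_of_nonneg_left (R.γ_pos j m).le two_pos hα
      have h3 : γbar j ≤ ⨆ j, γbar j := le_ciSup (Set.finite_range γbar).bddAbove j
      linarith [hR.1 j m]
    · intro k _ hk
      rw [PiLp.sub_apply, R.posAfter_of_ne hk, sub_self, zero_pow two_ne_zero]
    · simp
    · intro k _ hk
      rw [R.posAfter_of_ne hk, sub_self, mul_zero]
    · simp

theorem Controlled.decrement_of_stronglyConvex (hR : R.Controlled α εF εB γbar) (hα : 2 ≤ α)
    (hF : 0 < εF) (hB : 0 < εB) (hsum : 1 / α + 2 * εB + 2 * εF < 1) (hW : R.IsCharge εF εB W)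
    (h0 : φ pstar = 0) (hc : 0 < c) (hsc : StronglyConvex φ c) (hpos : 0 < φ (R.pos 0)) {T : ℝ}
    (hT : 0 ≤ T) :
    (1 + (1 - 1 / α - εB - εF / 2) / 12 * (c / ⨆ j, γbar j)) * R.potential W (T + 2) ≤
      R.potential W (T - 1) := by
  have hcG := hR.le_of_stronglyConvex hα hF hB hsum hW h0 hc hsc hpos
  obtain ⟨s, S, hs, hS, -, hgrad, hle, hdec⟩ := hR.exists_potential_le hα hF hB hsum hW hT
  have h1 := hsc.sub_le hc (R.pos s) pstar
  rw [h0, sub_zero] at h1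
  set η := 1 - 1 / α - εB - εF / 2 with hη_def
  have hη : 0 < η := by linarith
  generalize (⨆ j, γbar j) = G at *
  have hG : 0 < G := hc.trans_le hcG
  have h2 : (∑ j, partialDeriv j φ (R.pos s) ^ 2) / (2 * c) ≤ 3 * G * S / (2 * c) :=
    div_le_div_of_nonneg_right hgrad (by positivity)
  -- `3 / 2` comes from the gradient bound and `1` from the outstanding charges, using `c ≤ G`. The
  -- factor `η / 12` below leaves ample room.
  have h3 : c / G * R.potential W (T + 2) ≤ 5 / 2 * S := by
    calc c / G * R.potential W (T + 2) ≤ c / G * (3 * G * S / (2 * c) + S) :=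
          mul_le_mul_of_nonneg_left (by linarith) (by positivity)
      _ = 3 / 2 * S + c / G * S := by field_simp
      _ ≤ 3 / 2 * S + 1 * S := by
          have := mul_le_mul_of_nonneg_right ((div_le_one hG).2 hcG) hS
          linarith
      _ = _ := by ring
  have h4 := mul_le_mul_of_nonneg_left h3 (show 0 ≤ η / 12 by positivity)
  have h5 : 0 ≤ η * S := by positivity
  linarith

end AGDRun

/-! ### Decay rates in continuous time. -/

/-- Continuous-time consequences of a decrement estimate over periods of three time units. -/
theorem sublinear_decay {P : ℝ → ℝ} {ν M : ℝ} (hν : 0 < ν) (hν1 : ν ≤ 1) (hM : 0 < M)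
    (hP : ∀ t, 0 ≤ t → 0 ≤ P t) (hanti : ∀ s t, 0 ≤ s → s ≤ t → P t ≤ P s)
    (h : ∀ T, 0 ≤ T → ν * P (T + 3) * min M (P (T + 3)) ≤ M * (P T - P (T + 3))) :
    (P 0 ≤ M → ∀ t, 0 < t → P t ≤ 6 / ν * (M / t)) ∧
    (M < P 0 → ∀ t', t' = 3 / Real.log (1 + ν) * Real.log (P 0 / M) →
      (∀ t, 0 ≤ t → t ≤ t' → P t ≤
        6 / ν * ((2 : ℝ) ^ (-(Real.log (1 + ν) / (3 * Real.log 2) * t)) * P 0)) ∧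
      (∀ t, t' < t → P t ≤ 6 / ν * (M / (t - t')))) := by
  set F : ℕ → ℝ := fun k => P (3 * k) with hF_def
  have hF0 : F 0 = P 0 := by simp [hF_def]
  have hF : ∀ k, 0 ≤ F k := fun k => hP _ (by positivity)
  have hdec : ∀ k, ν * F (k + 1) * min M (F (k + 1)) ≤ M * (F k - F (k + 1)) := by
    intro k
    have := h (3 * k) (by positivity)
    have he : (3 * k + 3 : ℝ) = 3 * ((k + 1 : ℕ) : ℝ) := by push_cast; ring
    rwa [he] at this
  have hfloor : ∀ t : ℝ, 0 ≤ t → P t ≤ F ⌊t / 3⌋₊ ∧ t < 3 * ⌊t / 3⌋₊ + 3 := by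
    intro t ht
    refine ⟨hanti _ _ (by positivity) ?_, ?_⟩
    · have := Nat.floor_le (show 0 ≤ t / 3 by positivity)
      linarith
    · have := Nat.lt_floor_add_one (t / 3)
      linarith
  have hC : 6 ≤ 6 / ν := (le_div_iff₀ hν).2 (by linarith)
  -- The slack 6 absorbs two roundings to multiples of 3: that of `t'` up to `3 k₀` and that of `t`
  -- down. It fixes the constant `6 / ν`.
  have hlate : ∀ (k₀ i : ℕ) (u : ℝ), F k₀ ≤ M → 0 < u → u ≤ 3 * i + 6 →
      F (k₀ + i) ≤ 6 / ν * (M / u) := by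
    intro k₀ i u hk₀ hu hui
    have h1 := mul_le_of_decrement hν hν1 hM hF hdec hk₀ i
    have h2 : u ≤ 6 / ν * (1 + ν / 2 * i) := by
      have : 6 / ν * (1 + ν / 2 * i) = 6 / ν + 3 * i := by field_simp; ring
      linarith
    rw [← mul_div_assoc, le_div_iff₀ hu]
    calc F (k₀ + i) * u ≤ F (k₀ + i) * (6 / ν * (1 + ν / 2 * i)) :=
          mul_le_mul_of_nonneg_left h2 (hF _)
      _ = 6 / ν * (F (k₀ + i) * (1 + ν / 2 * i)) := by ring
      _ ≤ 6 / ν * M := mul_le_mul_of_nonneg_left h1 (by positivity)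
  refine ⟨fun h0 t ht => ?_, fun h0 t' ht' => ?_⟩
  · obtain ⟨h1, h2⟩ := hfloor t ht.le
    have := hlate 0 ⌊t / 3⌋₊ t (by rwa [hF0]) ht (by linarith)
    rw [zero_add] at this
    exact h1.trans this
  set L := Real.log (1 + ν) with hL_def
  have hL : 0 < L := Real.log_pos (by linarith)
  have hP0 : 0 < P 0 := hM.trans h0
  have hlog : 0 < Real.log (P 0 / M) := Real.log_pos ((one_lt_div hM).2 h0)
  have ht'0 : 0 < t' := by rw [ht']; positivity
  -- `t'` is the moment at which the geometric envelope reaches `M`.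
  have hexpM : P 0 * Real.exp (-(t' * L / 3)) = M := by
    have : t' * L / 3 = Real.log (P 0 / M) := by rw [ht']; field_simp
    rw [this, Real.exp_neg, Real.exp_log (by positivity)]
    field_simp
  have hpow : ∀ k : ℕ, F 0 / (1 + ν) ^ k = P 0 * Real.exp (-(k * L)) := by
    intro k
    rw [hF0, Real.exp_neg, mul_comm (k : ℝ) L, Real.exp_mul, hL_def,
      Real.exp_log (by linarith), Real.rpow_natCast, div_eq_mul_inv]
  have hgeo : ∀ t, 0 ≤ t → P t ≤ max M (2 * (P 0 * Real.exp (-(t * L / 3)))) := by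
    intro t ht
    obtain ⟨h1, h2⟩ := hfloor t ht
    refine h1.trans ((le_max_of_decrement hν hM hdec _).trans (max_le_max le_rfl ?_))
    rw [hpow]
    -- Rounding `t / 3` down costs at most one factor `1 + ν ≤ 2`.
    have h3 : Real.exp (-(⌊t / 3⌋₊ * L)) ≤ (1 + ν) * Real.exp (-(t * L / 3)) := by
      have hexpL : 1 + ν = Real.exp L := (Real.exp_log (by linarith)).symm
      rw [hexpL, ← Real.exp_add]
      refine Real.exp_le_exp.2 ?_
      nlinarith
    have h4 : (1 + ν) * Real.exp (-(t * L / 3)) ≤ 2 * Real.exp (-(t * L / 3)) :=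
      mul_le_mul_of_nonneg_right (by linarith) (Real.exp_pos _).le
    calc _ ≤ P 0 * (2 * Real.exp (-(t * L / 3))) :=
          mul_le_mul_of_nonneg_left (h3.trans h4) hP0.le
      _ = _ := by ring
  refine ⟨fun t ht htt' => ?_, fun t htt' => ?_⟩
  · have hrw : (2 : ℝ) ^ (-(L / (3 * Real.log 2) * t)) = Real.exp (-(t * L / 3)) := by
      rw [Real.rpow_def_of_pos two_pos]
      congr 1
      have : Real.log 2 ≠ 0 := (Real.log_pos one_lt_two).ne'
      field_simp
    rw [hrw]
    have h1 : M ≤ P 0 * Real.exp (-(t * L / 3)) := by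
      rw [← hexpM]
      refine mul_le_mul_of_nonneg_left (Real.exp_le_exp.2 ?_) hP0.le
      nlinarith
    have h2 : 0 ≤ P 0 * Real.exp (-(t * L / 3)) := by positivity
    rw [mul_comm (Real.exp _)]
    refine (hgeo t ht).trans (max_le ?_ ?_)
    · nlinarith
    · exact mul_le_mul_of_nonneg_right (by linarith) h2
  · have ht0 : 0 < t := ht'0.trans htt'
    set k₀ := ⌈t' / 3⌉₊ with hk₀
    have hk₀1 : t' ≤ 3 * k₀ := by
      have := Nat.le_ceil (t' / 3)
      linarith
    have hk₀2 : 3 * k₀ < t' + 3 := by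
      have := Nat.ceil_lt_add_one (show 0 ≤ t' / 3 by positivity)
      linarith
    have hFk₀ : F k₀ ≤ M := by
      refine (le_max_of_decrement hν hM hdec k₀).trans (max_le le_rfl ?_)
      rw [hpow, ← hexpM]
      refine mul_le_mul_of_nonneg_left (Real.exp_le_exp.2 ?_) hP0.le
      nlinarith
    obtain ⟨h1, h2⟩ := hfloor t ht0.le
    rcases le_or_gt k₀ ⌊t / 3⌋₊ with hk | hk
    · obtain ⟨i, hi⟩ := Nat.exists_eq_add_of_le hk
      rw [hi] at h1 h2
      push_cast at h2
      exact h1.trans (hlate k₀ i (t - t') hFk₀ (by linarith) (by linarith))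
    -- Here `t` is within 3 of `t'`, and the geometric bound `2 M` suffices.
    · have hk' : ((⌊t / 3⌋₊ : ℝ)) + 1 ≤ k₀ := by exact_mod_cast hk
      have hlt : t - t' < 3 := by linarith
      have hle : P t ≤ 2 * M := by
        refine (hgeo t ht0.le).trans (max_le (by linarith) ?_)
        refine mul_le_mul_of_nonneg_left ?_ zero_le_two
        rw [← hexpM]
        refine mul_le_mul_of_nonneg_left (Real.exp_le_exp.2 ?_) hP0.le
        nlinarith
      rw [← mul_div_assoc, le_div_iff₀ (by linarith)]
      calc P t * (t - t') ≤ 2 * M * 3 :=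
            mul_le_mul hle hlt.le (by linarith) (by positivity)
        _ = 6 * M := by ring
        _ ≤ 6 / ν * M := mul_le_mul_of_nonneg_right hC hM.le

/-- Linear decay from a contraction over the first two, and then over every three, time units. -/
theorem linear_decay {P : ℝ → ℝ} {y : ℝ} (hy : 0 ≤ y) (hy1 : y ≤ 1)
    (hP0 : 0 ≤ P 0) (hanti : ∀ s t, 0 ≤ s → s ≤ t → P t ≤ P s)
    (h₀ : (1 + y) * P 2 ≤ P 0) (h : ∀ T, 0 ≤ T → (1 + y) * P (T + 3) ≤ P T) :
    (∀ t : ℝ, 0 ≤ t → P t ≤ 2 * (1 - y / 10) ^ t * P 0) ∧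
    (∀ t : ℝ, 2 ≤ t → P t ≤ (1 - y / 10) ^ t * P 0) := by
  set q := 1 - y / 10 with hq_def
  have hq0 : 0 < q := by linarith
  have hq1 : q ≤ 1 := by linarith
  have hlate : ∀ t : ℝ, 2 ≤ t → P t ≤ q ^ t * P 0 := by
    intro t ht
    have hseq : ∀ k : ℕ, (1 + y) ^ (k + 1) * P (3 * k + 2) ≤ P 0 := by
      intro k
      induction k with
      | zero => simpa using h₀
      | succ k ih =>
        have hk := h (3 * k + 2) (by positivity)
        have he : (3 * ((k + 1 : ℕ) : ℝ) + 2) = 3 * k + 2 + 3 := by push_cast; ring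
        rw [he, pow_succ, mul_assoc]
        exact (mul_le_mul_of_nonneg_left hk (by positivity)).trans ih
    set k := ⌊(t - 2) / 3⌋₊ with hk
    have hk1 : 3 * (k : ℝ) + 2 ≤ t := by
      have := Nat.floor_le (show 0 ≤ (t - 2) / 3 by linarith)
      linarith
    -- By time `t < 3 k + 5` there have been `k + 1` contractions, so at least one per five time
    -- units.
    have hk2 : t ≤ ((5 * (k + 1) : ℕ) : ℝ) := by
      have := Nat.lt_floor_add_one ((t - 2) / 3)
      push_cast
      have hk0 : (0 : ℝ) ≤ k := Nat.cast_nonneg k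
      rw [← hk] at this
      linarith
    -- Bernoulli gives `q ^ 5 ≥ 1 - y / 2`, and `(1 - y / 2) (1 + y) ≥ 1` for `0 ≤ y ≤ 1`. Hence the
    -- divisor 10 in `q`.
    have hq5 : 1 ≤ q ^ 5 * (1 + y) := by
      have h1 := one_add_mul_le_pow (show (-2 : ℝ) ≤ -(y / 10) by linarith) 5
      have h2 : 1 - y / 2 ≤ q ^ 5 := by
        rw [hq_def, sub_eq_add_neg]
        refine le_trans (le_of_eq ?_) h1
        push_cast; ring
      nlinarith
    have hqt : q ^ (5 * (k + 1)) ≤ q ^ t := by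
      rw [← Real.rpow_natCast]
      exact Real.rpow_le_rpow_of_exponent_ge hq0 hq1 hk2
    have hone : 1 ≤ q ^ (5 * (k + 1)) * (1 + y) ^ (k + 1) := by
      rw [pow_mul, ← mul_pow]
      exact one_le_pow₀ hq5
    refine (hanti _ _ (by positivity) hk1).trans ?_
    refine le_of_mul_le_mul_left ((hseq k).trans ?_) (show 0 < (1 + y) ^ (k + 1) by positivity)
    calc P 0 ≤ (q ^ (5 * (k + 1)) * (1 + y) ^ (k + 1)) * P 0 := le_mul_of_one_le_left hP0 hone
      _ ≤ (q ^ t * (1 + y) ^ (k + 1)) * P 0 := by gcongr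
      _ = _ := by ring
  refine ⟨fun t ht => ?_, hlate⟩
  rcases le_or_gt 2 t with h2 | h2
  · refine (hlate t h2).trans ?_
    have : 0 ≤ q ^ t * P 0 := by positivity
    linarith
  · have h1 : q ^ (2 : ℝ) ≤ q ^ t := Real.rpow_le_rpow_of_exponent_ge hq0 hq1 h2.le
    have h3 : 1 ≤ 2 * q ^ t := by
      rw [Real.rpow_two] at h1
      nlinarith
    exact (hanti 0 t le_rfl ht).trans (le_mul_of_one_le_left hP0 h3)

/-! ### The main theorem. -/

theorem theorem1 (α εF εB : ℝ) (hα : 2 ≤ α) (hF : 0 < εF) (hB : 0 < εB)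
    (hsum : 1 / α + 2 * εB + 2 * εF < 1) :
    ∃ a C κ D δ : ℝ, 0 < a ∧ 0 < C ∧ 0 < κ ∧ 0 < D ∧ 0 < δ ∧ δ < 1 ∧
      ∀ (n : ℕ) (φ : EuclideanSpace ℝ (Fin n) → ℝ) (pstar : EuclideanSpace ℝ (Fin n))
        (R : AGDRun φ) (γbar : Fin n → ℝ),
        ConvexOn ℝ Set.univ φ → TwiceDifferentiable φ →
        (∀ x, φ pstar ≤ φ x) → φ pstar = 0 →
        R.Controlled α εF εB γbar →
        -- (a)
        (Bornology.IsBounded {x | φ x ≤ 2 * φ (R.pos 0)} →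
          ∀ B M : ℝ, B = Metric.diam {x | φ x ≤ 2 * φ (R.pos 0)} →
            M = a * (B ^ 2 * ⨆ j, γbar j) →
            (φ (R.pos 0) ≤ M → ∀ t : ℝ, 0 < t → φ (R.pos t) ≤ C * (M / t)) ∧
            (M < φ (R.pos 0) → ∀ t' : ℝ, t' = D * Real.log (φ (R.pos 0) / M) →
              (∀ t : ℝ, 0 ≤ t → t ≤ t' →
                φ (R.pos t) ≤ C * ((2 : ℝ) ^ (-(κ * t)) * φ (R.pos 0))) ∧
              (∀ t : ℝ, t' < t → φ (R.pos t) ≤ C * (M / (t - t'))))) ∧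
        -- (b)
        (∀ c : ℝ, 0 < c → StronglyConvex φ c →
          (∀ t : ℝ, 0 ≤ t →
            φ (R.pos t) ≤ 2 * (1 - δ * (c / ⨆ j, γbar j)) ^ t * φ (R.pos 0)) ∧
          (∀ t : ℝ, 2 ≤ t →
            φ (R.pos t) ≤ (1 - δ * (c / ⨆ j, γbar j)) ^ t * φ (R.pos 0))) := by
  have hα0 : 0 < 1 / α := by positivity
  set ν := (1 - 1 / α - εB - εF / 2) / 12 with hν_def
  have hν : 0 < ν := by linarith
  have hν1 : ν ≤ 1 := by linarith
  have hL : 0 < Real.log (1 + ν) := Real.log_pos (by linarith)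
  have hlog2 : 0 < Real.log 2 := Real.log_pos one_lt_two
  refine ⟨1, 6 / ν, Real.log (1 + ν) / (3 * Real.log 2), 3 / Real.log (1 + ν), ν / 10,
    one_pos, by positivity, by positivity, by positivity, by positivity, by linarith, ?_⟩
  intro n φ pstar R γbar hconv hdiff hmin h0 hR
  obtain ⟨W, hW⟩ := hR.exists_isCharge hdiff hF hB
  have hφ0 : ∀ x, 0 ≤ φ x := fun x => h0 ▸ hmin x
  have hle : ∀ t, 0 ≤ t → φ (R.pos t) ≤ R.potential W t := fun t ht => hW.le_potential ht
  have hzero : R.potential W 0 = φ (R.pos 0) := R.potential_of_nonpos W le_rfl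
  have hanti : ∀ s t, 0 ≤ s → s ≤ t → R.potential W t ≤ R.potential W s := by
    intro s t _ hst
    have h1 := hR.potential_add_le hα hB hW hst
    have h2 := mul_nonneg (show 0 ≤ 1 - 1 / α - εB - εF / 2 by linarith) (R.totalEnergy_nonneg s t)
    linarith
  have hP : ∀ t, 0 ≤ t → 0 ≤ R.potential W t := fun t ht => (hφ0 _).trans (hle t ht)
  have hG0 : 0 ≤ ⨆ j, γbar j := Real.iSup_nonneg fun j => (R.γ_pos j 0).le.trans (hR.1 j 0)
  have hvanish : φ (R.pos 0) ≤ 0 → ∀ t, 0 ≤ t → φ (R.pos t) = 0 := fun h t ht =>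
    le_antisymm ((hle t ht).trans ((hanti 0 t le_rfl ht).trans (hzero.le.trans h))) (hφ0 _)
  refine ⟨?_, ?_⟩
  · intro hbdd B M hBdef hM
    rw [one_mul] at hM
    have hM0 : 0 ≤ M := by rw [hM]; positivity
    rcases hM0.eq_or_lt with hM0 | hM0
    -- `M = 0` only if the run starts at the minimum value; this includes `n = 0`, where the
    -- supremum of `γbar` is `0` by convention.
    · have hinit : φ (R.pos 0) ≤ 0 := by
        by_contra hpos
        push Not at hpos
        have hne : R.pos 0 ≠ pstar := fun h => by rw [h, h0] at hpos; exact lt_irrefl _ hpos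
        have hB0 : 0 < B := by
          rw [hBdef]
          refine (dist_pos.2 hne).trans_le (Metric.dist_le_diam_of_mem hbdd ?_ ?_)
          · change φ _ ≤ _; linarith
          · change φ _ ≤ _; linarith
        obtain ⟨j⟩ : Nonempty (Fin n) := by
          by_contra hempty
          rw [not_nonempty_iff] at hempty
          exact hne (Subsingleton.elim _ _)
        have hG : 0 < ⨆ j, γbar j := ((R.γ_pos j 0).trans_le (hR.1 j 0)).trans_le
          (le_ciSup (Set.finite_range γbar).bddAbove j)
        have : 0 < M := by rw [hM]; positivity
        linarith
      refine ⟨fun _ t ht => ?_, fun h => absurd h (by linarith)⟩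
      rw [hvanish hinit t ht.le, ← hM0, zero_div, mul_zero]
    · obtain ⟨h1, h2⟩ := sublinear_decay (P := R.potential W) hν hν1 hM0 hP hanti fun T hT => by
        have := hR.decrement_of_bounded hα hF hB hsum hW hconv hdiff.1 hmin h0 hbdd
          (M := M) (by rw [hM, hBdef]) (T := T + 1) (by linarith)
        rwa [add_sub_cancel_right, add_assoc, show (1 : ℝ) + 2 = 3 by norm_num] at this
      rw [hzero] at h1 h2
      refine ⟨fun h t ht => (hle t ht.le).trans (h1 h t ht), fun h t' ht' => ?_⟩
      have ht'0 : 0 ≤ t' := by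
        have := Real.log_pos ((one_lt_div hM0).2 h)
        rw [ht']; positivity
      obtain ⟨h3, h4⟩ := h2 h t' ht'
      exact ⟨fun t ht htt' => (hle t ht).trans (h3 t ht htt'),
        fun t htt' => (hle t (ht'0.trans htt'.le)).trans (h4 t htt')⟩
  · intro c hc hsc
    rcases (hφ0 (R.pos 0)).eq_or_lt with hinit | hinit
    · refine ⟨fun t ht => ?_, fun t ht => ?_⟩
      · rw [hvanish hinit.ge t ht, ← hinit, mul_zero]
      · rw [hvanish hinit.ge t (by linarith), ← hinit, mul_zero]
    · have hcG := hR.le_of_stronglyConvex hα hF hB hsum hW h0 hc hsc hinit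
      have hstep : ∀ T : ℝ, 0 ≤ T → _ := fun T hT =>
        hR.decrement_of_stronglyConvex hα hF hB hsum hW h0 hc hsc hinit (T := T) hT
      have hratio : c / (⨆ j, γbar j) ≤ 1 := div_le_one_of_le₀ hcG hG0
      have hratio0 : 0 ≤ c / (⨆ j, γbar j) := by positivity
      obtain ⟨h1, h2⟩ := linear_decay (P := R.potential W) (y := ν * (c / ⨆ j, γbar j))
        (by positivity) (mul_le_one₀ hν1 hratio0 hratio) (hP 0 le_rfl) hanti
        (by
          -- At `T = 0` the three-unit period starts at `-1`, where the potential still has its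
          -- initial value, so two units suffice for the first contraction.
          have := hstep 0 le_rfl
          rwa [zero_add, zero_sub, R.potential_of_nonpos W (by norm_num : (-1 : ℝ) ≤ 0),
            ← hzero] at this)
        (fun T hT => by
          have := hstep (T + 1) (by linarith)
          rwa [add_sub_cancel_right, add_assoc, show (1 : ℝ) + 2 = 3 by norm_num] at this)
      have hδ : ν / 10 * (c / ⨆ j, γbar j) = ν * (c / ⨆ j, γbar j) / 10 := by ring
      rw [hzero] at h1 h2
      rw [hδ]
      exact ⟨fun t ht => (hle t ht).trans (h1 t ht),
        fun t ht => (hle t (by linarith)).trans (h2 t ht)⟩
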